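/- Let $n\ge 0$ and let $M_{m\times n}$ be the space of complex $m\times n$ matrices, $M_n=M_{n\times n}$, with the inner product $(V\,|\,W)=\mathrm{Tr}(V^*W)$. A linear map $\phi:M_2\to M_n$ is completely positive if for every $k$ the map $[X_{pq}]\mapsto[\phi(X_{pq})]$ on $k\times k$ block matrices with blocks in $M_2$ preserves positive semidefiniteness; it is completely copositive if $X\mapsto\phi(X^{\rm t})$ is completely positive. Let $\mathbb D$ be the convex cone of decomposable positive maps, that is, of all sums of a completely positive and a completely copositive linear map from $M_2$ to $M_n$. For a subspace $D\subset M_{2\times n}$ let $$\Phi_D=\Big\{X\mapsto \sum_{i=1}^k V_i^*XV_i \;:\; k\ge 0,\ V_1,\dots,V_k\in D\Big\},$$ a convex cone contained in $\mathbb D$. A convex cone $F\subset\mathbb D$ is a face of $\mathbb D$ if $\phi,\psi\in\mathbb D$ and $\phi+\psi\in F$ imply $\phi,\psi\in F$. It is an exposed face of $\mathbb D$ if $F=\{\phi\in\mathbb D: l(\phi)=0\}$ for some real linear functional $l$ that is nonnegative on $\mathbb D$ ($l=0$ is allowed). Let $M_n^+\otimes M_2^+\subset M_n\otimes M_2$ be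 the convex cone of all finite sums of $y\otimes x$ with $y\in M_n$, $x\in M_2$ positive semidefinite (the cone generated by the separable states), and let $\langle\cdot,\cdot\rangle$ be the bilinear pairing between $M_n\otimes M_2$ and the linear maps $M_2\to M_n$ with $\langle y\otimes x,\phi\rangle=\mathrm{Tr}(\phi(x)y^{\rm t})$. A face $F$ of $\mathbb D$ is exposed by separable states if $F=\{\phi\in\mathbb D:\langle A,\phi\rangle=0\}$ for some $A\in M_n^+\otimes M_2^+$. A product vector is a matrix of the form $\xi\eta^*\in M_{2\times n}$ with $\xi\in\mathbb C^2$, $\eta\in\mathbb C^n$ (a matrix of rank at most one; zero is included). **Theorem.** For every subspace $D$ of $M_{2\times n}$ the following are equivalent: 1. $\Phi_D$ is an exposed face of $\mathbb D$. 2. $\Phi_D$ is a face of $\mathbb D$ which is exposed by separable states. 3. The set of product vectors in $D$ is a subspace, and the orthogonal complement $D^\perp$ is spanned by product vectors. -/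

import Mathlib

open scoped ComplexOrder

namespace Decomp

/-- `m × n` complex matrices. -/
abbrev Mat (m n : ℕ) : Type := Matrix (Fin m) (Fin n) ℂ

/-- The complex linear maps from `M_m` to `M_n`; it is regarded as a real vector space when
convex cones in it are considered. -/
abbrev MapSpace (m n : ℕ) : Type := Mat m m →ₗ[ℂ] Mat n n

/-! ### Faces of convex cones -/

section Cone

variable {E : Type*} [AddCommGroup E] [Module ℝ E]

/-- `F` is an exposed face of the convex cone `C`: it is the zero set in `C` of a real linear
functional that is nonnegative on `C`.  (All spaces below are finite dimensional, so that linear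
functionals are automatically continuous.  The cone itself is an exposed face, with `l = 0`.) -/
def IsExposedFace (F C : PointedCone ℝ E) : Prop :=
  ∃ l : E →ₗ[ℝ] ℝ, (∀ x ∈ C, 0 ≤ l x) ∧ ∀ x, x ∈ F ↔ x ∈ C ∧ l x = 0

end Cone

/-! ### The cones of completely positive, completely copositive and decomposable maps -/

/-- Complete positivity: for every `k`, the map `[X_{pq}] ↦ [φ(X_{pq})]` on `k × k` block matrices
with blocks in `M_m` preserves positive semidefiniteness. -/
def IsCP {m n : ℕ} (φ : MapSpace m n) : Prop :=
  ∀ (k : ℕ) (X : Matrix (Fin k) (Fin k) (Mat m m)),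
    (Matrix.comp _ _ _ _ _ X).PosSemidef →
      (Matrix.comp _ _ _ _ _ (X.map φ)).PosSemidef

/-- The transpose map on `M_m` as a linear map. -/
def transposeMap (m : ℕ) : Mat m m →ₗ[ℂ] Mat m m :=
  (Matrix.transposeLinearEquiv (Fin m) (Fin m) ℂ ℂ).toLinearMap

/-- Complete copositivity: `X ↦ φ(Xᵗ)` is completely positive. -/
def IsCCP {m n : ℕ} (φ : MapSpace m n) : Prop :=
  IsCP (φ ∘ₗ transposeMap m)

theorem IsCP.zero {m n : ℕ} : IsCP (0 : MapSpace m n) := by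
  intro k X _
  have h : Matrix.comp _ _ _ _ _ (X.map (0 : MapSpace m n)) = 0 := by
    ext a b; rfl
  rw [h]
  exact Matrix.PosSemidef.zero

theorem IsCP.add {m n : ℕ} {φ ψ : MapSpace m n} (hφ : IsCP φ) (hψ : IsCP ψ) : IsCP (φ + ψ) := by
  intro k X hX
  have h : Matrix.comp _ _ _ _ _ (X.map (φ + ψ)) =
      Matrix.comp _ _ _ _ _ (X.map φ) + Matrix.comp _ _ _ _ _ (X.map ψ) := by
    ext a b; rfl
  rw [h]
  exact (hφ k X hX).add (hψ k X hX)

theorem IsCP.smul {m n : ℕ} {φ : MapSpace m n} (hφ : IsCP φ) {c : ℝ} (hc : 0 ≤ c) :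
    IsCP (c • φ) := by
  intro k X hX
  have h : Matrix.comp _ _ _ _ _ (X.map (c • φ)) =
      c • Matrix.comp _ _ _ _ _ (X.map φ) := by
    ext a b; rfl
  rw [h]
  exact (hφ k X hX).smul hc

/-- The convex cone of all completely positive linear maps from `M_m` to `M_n`. -/
def cpCone (m n : ℕ) : PointedCone ℝ (MapSpace m n) where
  carrier := {φ | IsCP φ}
  zero_mem' := IsCP.zero
  add_mem' := fun h h' => IsCP.add h h'
  smul_mem' := fun c _ h => IsCP.smul h c.2

/-- The convex cone of all completely copositive linear maps from `M_m` to `M_n`. -/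
def ccpCone (m n : ℕ) : PointedCone ℝ (MapSpace m n) where
  carrier := {φ | IsCCP φ}
  zero_mem' := by
    have h : (0 : MapSpace m n) ∘ₗ transposeMap m = 0 := LinearMap.zero_comp _
    simpa only [Set.mem_ofPred_eq, IsCCP, h] using IsCP.zero
  add_mem' := fun {φ ψ} h h' => by
    simpa only [Set.mem_ofPred_eq, IsCCP, LinearMap.add_comp] using IsCP.add h h'
  smul_mem' := fun c φ h => by
    have h' := IsCP.smul h c.2
    exact h'

/-- The convex cone of all decomposable positive linear maps from `M_m` to `M_n`, that is, of all
sums of a completely positive and a completely copositive linear map. -/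
noncomputable def decCone (m n : ℕ) : PointedCone ℝ (MapSpace m n) :=
  cpCone m n ⊔ ccpCone m n

theorem mem_decCone {m n : ℕ} {φ : MapSpace m n} :
    φ ∈ decCone m n ↔ ∃ φ₁, IsCP φ₁ ∧ ∃ φ₂, IsCCP φ₂ ∧ φ₁ + φ₂ = φ :=
  Submodule.mem_sup

/-! ### The face of the completely positive cone given by a subspace -/

/-- The elementary completely positive map `X ↦ V* X V` given by an `m × n` matrix `V`. -/
def elemMap {m n : ℕ} (V : Mat m n) : MapSpace m n where
  toFun X := V.conjTranspose * X * V
  map_add' X Y := by rw [Matrix.mul_add, Matrix.add_mul]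
  map_smul' c X := by rw [Matrix.mul_smul, Matrix.smul_mul, RingHom.id_apply]

/-- The face of the completely positive cone given by a subspace `D` of `m × n` matrices: all
finite sums of maps `X ↦ V* X V` with `V ∈ D`. -/
def faceOf {m n : ℕ} (D : Submodule ℂ (Mat m n)) : PointedCone ℝ (MapSpace m n) where
  carrier := {φ | ∃ (k : ℕ) (V : Fin k → Mat m n), (∀ i, V i ∈ D) ∧ φ = ∑ i, elemMap (V i)}
  zero_mem' := ⟨0, Fin.elim0, fun i => i.elim0, by simp⟩
  add_mem' := by
    rintro _ _ ⟨k, V, hV, rfl⟩ ⟨l, W, hW, rfl⟩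
    refine ⟨k + l, Fin.append V W, fun i => ?_, ?_⟩
    · refine Fin.addCases (fun j => ?_) (fun j => ?_) i
      · simpa using hV j
      · simpa using hW j
    · simp [Fin.sum_univ_add]
  smul_mem' := by
    rintro ⟨c, hc⟩ _ ⟨k, V, hV, rfl⟩
    refine ⟨k, fun i => ((Real.sqrt c : ℝ) : ℂ) • V i, fun i => D.smul_mem _ (hV i), ?_⟩
    have hs : ((Real.sqrt c : ℝ) : ℂ) * ((Real.sqrt c : ℝ) : ℂ) = (c : ℂ) := by
      rw [← Complex.ofReal_mul, Real.mul_self_sqrt hc]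
    have key : ∀ v : Mat m n,
        elemMap (((Real.sqrt c : ℝ) : ℂ) • v) = c • elemMap v := by
      intro v
      ext1 X
      change ((Real.sqrt c : ℂ) • v).conjTranspose * X * ((Real.sqrt c : ℂ) • v) =
        c • (v.conjTranspose * X * v)
      rw [Matrix.conjTranspose_smul, Matrix.smul_mul, Matrix.smul_mul, Matrix.mul_smul, smul_smul,
        Complex.star_def, Complex.conj_ofReal, hs, Complex.coe_smul]
    rw [Finset.sum_congr rfl (fun i _ => key (V i)), ← Finset.smul_sum]
    rfl

/-! ### Separable block matrices and the duality pairing -/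

/-- The pairing `⟨A, φ⟩` between `M_n ⊗ M_m` and the linear maps from `M_m` to `M_n`, where
`M_n ⊗ M_m` is identified (by the Kronecker product) with the matrices indexed by pairs.  Writing
`A = ∑ A_{ij} ⊗ e_{ij}`, it is `∑ Tr (φ(e_{ij}) A_{ij}ᵗ)`; it is determined by
`⟨y ⊗ x, φ⟩ = Tr (φ(x) yᵗ)`, see `pairing_kronecker`. -/
def pairing {m n : ℕ} (A : Matrix (Fin n × Fin m) (Fin n × Fin m) ℂ) (φ : MapSpace m n) : ℂ :=
  ∑ i : Fin m, ∑ j : Fin m,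
    Matrix.trace (φ (Matrix.single i j 1) *
      (A.submatrix (fun p => (p, i)) (fun q => (q, j))).transpose)

theorem pairing_kronecker {m n : ℕ} (y : Mat n n) (x : Mat m m) (φ : MapSpace m n) :
    pairing (Matrix.kronecker y x) φ = Matrix.trace (φ x * y.transpose) := by
  have hx : φ x = ∑ i : Fin m, ∑ j : Fin m, x i j • φ (Matrix.single i j 1) := by
    conv_lhs => rw [Matrix.matrix_eq_sum_single x]
    simp only [map_sum, ← map_smul, Matrix.smul_single, smul_eq_mul, mul_one]
  rw [hx]
  simp only [pairing, Matrix.sum_mul, Matrix.trace_sum, Matrix.smul_mul, Matrix.trace_smul]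
  refine Finset.sum_congr rfl fun i _ => Finset.sum_congr rfl fun j _ => ?_
  have h : (Matrix.kronecker y x).submatrix (fun p => (p, i)) (fun q => (q, j)) = x i j • y := by
    ext a b
    simp [Matrix.kronecker, mul_comm]
  rw [h, Matrix.transpose_smul, Matrix.mul_smul, Matrix.trace_smul]

/-- The convex cone `M_n⁺ ⊗ M_m⁺` generated by the separable states in `M_n ⊗ M_m`: all finite
sums of `y ⊗ x` with `x` and `y` positive semidefinite. -/
noncomputable def sepCone (m n : ℕ) : PointedCone ℝ (Matrix (Fin n × Fin m) (Fin n × Fin m) ℂ) :=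
  PointedCone.hull ℝ {A | ∃ (y : Mat n n) (x : Mat m m),
    y.PosSemidef ∧ x.PosSemidef ∧ A = Matrix.kronecker y x}

/-- `F` is a face of the cone of decomposable maps that is exposed by separable states. -/
def IsFaceExposedBySeparable {m n : ℕ} (F : PointedCone ℝ (MapSpace m n)) : Prop :=
  F.IsFaceOf (decCone m n) ∧
    ∃ A ∈ sepCone m n, ∀ φ, φ ∈ F ↔ φ ∈ decCone m n ∧ pairing A φ = 0

/-! ### Product vectors -/

/-- Product vectors in `M_{m × n} = ℂⁿ ⊗ ℂᵐ`: the matrices `ξ η*` (zero included), that is, the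
matrices of rank at most one. -/
def IsProductVector {m n : ℕ} (V : Mat m n) : Prop :=
  ∃ (ξ : Fin m → ℂ) (η : Fin n → ℂ), V = Matrix.vecMulVec ξ (star η)

/-- The orthogonal complement of `D` for the inner product `⟨V, W⟩ = Tr (V* W)`. -/
def orthCompl {m n : ℕ} (D : Submodule ℂ (Mat m n)) : Submodule ℂ (Mat m n) where
  carrier := {W | ∀ V ∈ D, Matrix.trace (V.conjTranspose * W) = 0}
  zero_mem' := fun V _ => by simp
  add_mem' := fun {W W'} h h' V hV => by
    rw [Matrix.mul_add, Matrix.trace_add, h V hV, h' V hV, add_zero]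
  smul_mem' := fun c W h V hV => by
    rw [Matrix.mul_smul, Matrix.trace_smul, h V hV, smul_zero]

end Decomp

/-!
The equivalence rests on two facts: exposing functionals give two positive semidefinite quadratic
forms, and the product vectors orthogonal to a subspace of `ℂ² ⊗ ℂⁿ` are controlled by a linear
pencil.

A `2 × n` matrix is identified with the pair of its rows, an element of `ℂ² ⊗ M = M × M` with
`M = ℂⁿ`; product vectors are the simple tensors `(a • m, b • m)`.  Duality
(`span_productVectors_eq_orthCompl_iff`) turns the second half of the third condition into: an
element `w` each of whose contractions `α w₀ + β w₁` is the contraction of an element of `D` lies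
in `D`.

Consider the condition `Saturated D`: if `ξ ⊗ s` lies in `D` and some `d ∈ D` contracts to `s` along
the functional annihilating `ξ`, then `ℂ² ⊗ s ⊆ D`.  It is an easy consequence of the third
condition (`saturated_of_contract_closed`).  It also follows if `Φ_D` is exposed by a functional `l`
(`IsExposedFace.saturated`).  Indeed `V ↦ l (X ↦ V* X V)` and `W ↦ l (X ↦ W* Xᵗ W)` are positive
semidefinite forms.  The null space of the first one is `D`.  That of the second consists of product
vectors, because `X ↦ W* Xᵗ W` belongs to `Φ_D`, hence is completely positive, for `W` in it; it is
the set of partial conjugates of the product vectors of `D`.  A space of product vectors is `ξ ⊗ S`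
or `ℂ² ⊗ f`, so its set of partial conjugates is a subspace as well.  Finally a cross term of the
first form on simple tensors is a cross term of the second one, which vanishes if one of its
arguments is a null vector.

Conversely let `D` be saturated with product vectors forming a subspace.  If `S` is the space of
second factors of these product vectors, then `D` has no simple tensor modulo `ℂ² ⊗ S`
(`Saturated.exists_submodule`).  For a space without simple tensors, an element `w` for which
`w₀ + μ w₁` is a contraction of an element of `D` for infinitely many `μ` lies in `D`
(`mem_of_contract_mem`); the proof is an eigenvector argument.  This gives the spanning of `D^⊥` by
product vectors (`Saturated.mem_of_contract_mem`).  The same statement, applied on two circles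
`|μ| = r`, shows that an element orthogonal to the partial conjugates of the product vectors of
`D^⊥` is itself the partial conjugate of a product vector in `D`
(`Saturated.exists_of_contract_mem_conj`).  With Kraus decompositions this says exactly that the sum
of the product states of sufficiently many product vectors of `D^⊥` exposes `Φ_D`
(`isFaceExposedBySeparable_faceOf`).
-/

namespace Decomp

/-! ### Linear pencils without simple tensors -/

section Pencil

variable {M : Type*} [AddCommGroup M] [Module ℂ M]

/-- The contraction of `v ∈ ℂ² ⊗ M` with the functional on `ℂ²` of coefficients `α`, `β`.  An
element of `ℂ² ⊗ M` is encoded as the pair of its two rows, an element of `M × M`. -/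
def contract (α β : ℂ) : M × M →ₗ[ℂ] M :=
  α • LinearMap.fst ℂ M M + β • LinearMap.snd ℂ M M

theorem contract_apply (α β : ℂ) (v : M × M) : contract α β v = α • v.1 + β • v.2 := rfl

/-- Simple tensors `(a, b) ⊗ m` in `ℂ² ⊗ M = M × M`. -/
def IsPure (v : M × M) : Prop := ∃ (a b : ℂ) (m : M), v = (a • m, b • m)

/-- A vector that lies in almost all the spaces `{d₀ + μ d₁ : d ∈ D}`, `μ ∈ Z`, vanishes if `D`
contains no simple tensor.  Such vectors form a space `Y`; for a suitable `μ₀ ∈ Z`, every `y ∈ Y`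
is `d₀ + μ₀ d₁` with `d ∈ D`, and then `d₁ ∈ Y`.  An eigenvector of `y ↦ d₁` would produce a simple
tensor in `D`. -/
theorem eq_zero_of_eventually_mem_contract [FiniteDimensional ℂ M] {D : Submodule ℂ (M × M)}
    (hD : ∀ v ∈ D, IsPure v → v = 0) {Z : Set ℂ} (hZ : Z.Infinite) {y : M}
    (hy : ∀ᶠ μ in Filter.cofinite ⊓ Filter.principal Z, y ∈ D.map (contract 1 μ)) : y = 0 := by
  set l : Filter ℂ := Filter.cofinite ⊓ Filter.principal Z with hl
  have hne : l.NeBot := Filter.cofinite_inf_principal_neBot_iff.2 hZ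
  let Y : Submodule ℂ M :=
    { carrier := {y | ∀ᶠ μ in l, y ∈ D.map (contract 1 μ)}
      zero_mem' := by
        change ∀ᶠ μ in l, (0 : M) ∈ D.map (contract 1 μ)
        exact Filter.Eventually.of_forall fun μ => Submodule.zero_mem _
      add_mem' := fun {a b} ha hb => by
        change ∀ᶠ μ in l, a + b ∈ D.map (contract 1 μ)
        filter_upwards [ha, hb] with μ h1 h2 using Submodule.add_mem _ h1 h2
      smul_mem' := fun c a ha => by
        change ∀ᶠ μ in l, c • a ∈ D.map (contract 1 μ)
        filter_upwards [ha] with μ h1 using Submodule.smul_mem _ c h1 }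
  have hYmem : ∀ z, z ∈ Y ↔ ∀ᶠ μ in l, z ∈ D.map (contract 1 μ) := fun z => Iff.rfl
  obtain ⟨s, hs⟩ : Y.FG := IsNoetherian.noetherian Y
  have hall : ∀ᶠ μ in l, Y ≤ D.map (contract 1 μ) := by
    have h1 : ∀ᶠ μ in l, ∀ z ∈ s, z ∈ D.map (contract 1 μ) := by
      rw [Filter.eventually_all_finset]
      intro z hz
      rw [← hYmem, ← hs]
      exact Submodule.subset_span hz
    filter_upwards [h1] with μ hμ
    rw [← hs, Submodule.span_le]
    exact hμ
  obtain ⟨μ₀, hμ₀⟩ := hall.exists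
  let D' : Submodule ℂ (M × M) := D ⊓ Y.comap (contract 1 μ₀)
  let N : D' →ₗ[ℂ] Y := ((contract 1 μ₀).domRestrict D').codRestrict Y fun d => d.2.2
  have hNinj : Function.Injective N := by
    rw [← LinearMap.ker_eq_bot, LinearMap.ker_eq_bot']
    rintro ⟨d, hd⟩ h
    have h' : (1 : ℂ) • d.1 + μ₀ • d.2 = 0 := congrArg Subtype.val h
    have : d = 0 := hD d hd.1 ⟨-μ₀, 1, d.2, by
      ext
      · linear_combination (norm := module) h'
      · simp⟩
    exact Subtype.ext this
  have hNsurj : Function.Surjective N := by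
    rintro ⟨z, hz⟩
    obtain ⟨d, hd, hdz⟩ := hμ₀ hz
    exact ⟨⟨d, hd, by simpa [hdz] using hz⟩, Subtype.ext hdz⟩
  let e := LinearEquiv.ofBijective N ⟨hNinj, hNsurj⟩
  have hne' : ∀ᶠ μ in l, μ ≠ μ₀ :=
    Filter.Eventually.filter_mono inf_le_left (Set.finite_singleton μ₀).eventually_cofinite_notMem
  have hsnd : ∀ d : D', (d : M × M).2 ∈ Y := by
    rintro ⟨d, hd⟩
    rw [hYmem]
    filter_upwards [hd.2, hne'] with μ h1 h2
    have h3 : (μ - μ₀) • d.2 ∈ D.map (contract 1 μ) := by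
      have := Submodule.sub_mem _ (Submodule.mem_map_of_mem (f := contract 1 μ) hd.1) h1
      convert this using 1
      simp only [contract_apply]
      module
    exact (Submodule.smul_mem_iff _ (sub_ne_zero.2 h2)).1 h3
  let L : Module.End ℂ Y :=
    (((LinearMap.snd ℂ M M).domRestrict D').codRestrict Y hsnd) ∘ₗ e.symm.toLinearMap
  by_contra hy0
  have : Nontrivial Y := ⟨⟨⟨y, hy⟩, 0, fun h => hy0 (congrArg Subtype.val h)⟩⟩
  obtain ⟨c, hc⟩ := Module.End.exists_eigenvalue L
  obtain ⟨v, hv⟩ := hc.exists_hasEigenvector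
  set d := e.symm v with hd
  have h1 : (d : M × M).2 = c • (v : M) := congrArg Subtype.val hv.apply_eq_smul
  have h2 : (1 : ℂ) • (d : M × M).1 + μ₀ • (d : M × M).2 = v :=
    congrArg Subtype.val (e.apply_symm_apply v)
  have h3 : (d : M × M) = 0 := hD _ d.2.1 ⟨1 - μ₀ * c, c, v, by
    ext
    · simp only [h1] at h2 ⊢
      linear_combination (norm := module) h2
    · exact h1⟩
  have h4 : d = 0 := Subtype.ext h3
  exact hv.2 (e.symm.map_eq_zero_iff.1 h4)

/-- If `D` contains no simple tensor and the contraction `w₀ + μ w₁` lies in the contraction of `D`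
for infinitely many `μ`, then `w` lies in `D`. -/
theorem mem_of_contract_mem [FiniteDimensional ℂ M] {D : Submodule ℂ (M × M)}
    (hD : ∀ v ∈ D, IsPure v → v = 0) {Z : Set ℂ} (hZ : Z.Infinite) {w : M × M}
    (hw : ∀ μ ∈ Z, contract 1 μ w ∈ D.map (contract 1 μ)) : w ∈ D := by
  obtain ⟨μ₀, hμ₀⟩ := hZ.nonempty
  obtain ⟨d, hd, hdw⟩ := hw μ₀ hμ₀
  have key : w.2 - d.2 = 0 := by
    refine eq_zero_of_eventually_mem_contract hD hZ ?_
    have hne : ∀ᶠ μ in Filter.cofinite ⊓ Filter.principal Z, μ ≠ μ₀ :=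
      Filter.Eventually.filter_mono inf_le_left
        (Set.finite_singleton μ₀).eventually_cofinite_notMem
    have hmem : ∀ᶠ μ in Filter.cofinite ⊓ Filter.principal Z, μ ∈ Z :=
      Filter.Eventually.filter_mono inf_le_right (Filter.mem_principal_self Z)
    filter_upwards [hne, hmem] with μ h1 h2
    refine (Submodule.smul_mem_iff _ (sub_ne_zero.2 h1)).1 ?_
    have := Submodule.sub_mem _ (hw μ h2) (Submodule.mem_map_of_mem (f := contract 1 μ) hd)
    convert this using 1
    simp only [contract_apply] at hdw ⊢
    linear_combination (norm := module) hdw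
  have h2 : w.2 = d.2 := sub_eq_zero.1 key
  have h1 : w.1 = d.1 := by
    simp only [contract_apply, h2] at hdw
    simpa using hdw.symm
  rwa [Prod.ext h1 h2]

open ComplexConjugate in
/-- If `D` contains no simple tensor, the only `w` each of whose contractions lies in the complex
conjugate contraction of `D` is zero.  On the circle `|μ| = r` the hypothesis turns into the one of
`mem_of_contract_mem` for the vector `(r² w₁, w₀)`; two radii are compared. -/
theorem eq_zero_of_contract_mem_conj [FiniteDimensional ℂ M] {D : Submodule ℂ (M × M)}
    (hD : ∀ v ∈ D, IsPure v → v = 0) {w : M × M}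
    (hw : ∀ α β : ℂ, contract α β w ∈ D.map (contract (conj α) (conj β))) : w = 0 := by
  have key : ∀ r : ℝ, 0 < r → (((r ^ 2 : ℝ) : ℂ) • w.2, w.1) ∈ D := by
    intro r hr
    have hinf : (Metric.sphere (0 : ℂ) r).Infinite := by
      refine IsPreconnected.infinite_of_nontrivial
        (isPreconnected_sphere (by rw [Complex.rank_real_complex]; norm_num) 0 r) ?_
      refine ⟨(r : ℂ), by simp [abs_of_pos hr], -(r : ℂ), by simp [abs_of_pos hr], ?_⟩
      intro h
      have : (r : ℂ) = 0 := by linear_combination h / 2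
      exact hr.ne' (by exact_mod_cast this)
    refine mem_of_contract_mem hD hinf fun μ hμ => ?_
    have h1 := Submodule.smul_mem _ μ (hw 1 (conj μ))
    simp only [map_one, Complex.conj_conj] at h1
    convert h1 using 1
    -- multiplication by `μ` exchanges the two entries, as `μ̄ = r² / μ` on the circle of radius `r`
    have h2 : μ * conj μ = ((r ^ 2 : ℝ) : ℂ) := by
      rw [Complex.mul_conj, Complex.normSq_eq_norm_sq, mem_sphere_zero_iff_norm.1 hμ]
    simp only [contract_apply, ← h2]
    module
  have h1 := key 1 one_pos
  have h2 := key 2 two_pos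
  have hw2 : w.2 = 0 := by
    have h3 : ((3 : ℂ) • w.2, (0 : ℂ) • w.2) ∈ D := by
      convert D.sub_mem h2 h1 using 1
      ext
      · simp only [Prod.fst_sub]; push_cast; module
      · simp
    have h4 := congrArg Prod.fst (hD _ h3 ⟨3, 0, w.2, rfl⟩)
    simpa using h4
  have hw1 : w.1 = 0 := by
    have h4 := congrArg Prod.snd (hD _ h1 ⟨0, 1, w.1, by simp [hw2]⟩)
    simpa using h4
  exact Prod.ext hw1 hw2

end Pencil

/-! ### Spaces of simple tensors and saturated spaces -/

section Structure

variable {M : Type*} [AddCommGroup M] [Module ℂ M]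

theorem isPure_smul (a b : ℂ) (m : M) : IsPure (a • m, b • m) := ⟨a, b, m, rfl⟩

theorem exists_eq_smul_of_proportional {a b : ℂ} (hab : a ≠ 0 ∨ b ≠ 0) {v : M × M}
    (h : a • v.2 = b • v.1) {S : Submodule ℂ M} (h1 : v.1 ∈ S) (h2 : v.2 ∈ S) :
    ∃ u ∈ S, v = (a • u, b • u) := by
  by_cases ha : a = 0
  · have hb : b ≠ 0 := hab.resolve_left (not_not.2 ha)
    refine ⟨b⁻¹ • v.2, S.smul_mem _ h2, Prod.ext ?_ ?_⟩
    · have : b • v.1 = 0 := by rw [← h, ha, zero_smul]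
      rw [ha, zero_smul, (smul_eq_zero.1 this).resolve_left hb]
    · exact (smul_inv_smul₀ hb _).symm
  · refine ⟨a⁻¹ • v.1, S.smul_mem _ h1, Prod.ext ?_ ?_⟩
    · exact (smul_inv_smul₀ ha _).symm
    · change v.2 = b • a⁻¹ • v.1
      rw [smul_comm, ← h, inv_smul_smul₀ ha]

/-- Two simple tensors of a space of simple tensors have proportional second factors if their first
factors are linearly independent. -/
theorem exists_eq_smul_of_independent {E : Submodule ℂ (M × M)} (hE : ∀ v ∈ E, IsPure v)
    {a b a' b' : ℂ} {f f' : M} (h : (a • f, b • f) ∈ E) (h' : (a' • f', b' • f') ∈ E)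
    (hdet : a * b' - a' * b ≠ 0) (hf : f ≠ 0) : ∃ c : ℂ, f' = c • f := by
  obtain ⟨x, y, m, hm⟩ := hE _ (E.add_mem h h')
  have h1 : a • f + a' • f' = x • m := congrArg Prod.fst hm
  have h2 : b • f + b' • f' = y • m := congrArg Prod.snd hm
  have h3 : (y * a - x * b) • f + (y * a' - x * b') • f' = 0 := by
    linear_combination (norm := module) y • h1 - x • h2
  by_cases hk : y * a' - x * b' = 0
  · rw [hk, zero_smul, add_zero] at h3
    have h4 : y * a - x * b = 0 := (smul_eq_zero.1 h3).resolve_right hf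
    have hx : x = 0 := by
      refine (mul_eq_zero.1 ?_).resolve_right hdet
      linear_combination a' * h4 - a * hk
    have hy : y = 0 := by
      refine (mul_eq_zero.1 ?_).resolve_right hdet
      linear_combination b' * h4 - b * hk
    rw [hx, zero_smul] at h1
    rw [hy, zero_smul] at h2
    have h5 : (a * b' - a' * b) • f = 0 := by
      linear_combination (norm := module) b' • h1 - a' • h2
    exact absurd ((smul_eq_zero.1 h5).resolve_left hdet) hf
  · refine ⟨-(y * a' - x * b')⁻¹ * (y * a - x * b), ?_⟩
    have h4 : (y * a' - x * b') • f' = -((y * a - x * b) • f) := by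
      linear_combination (norm := module) h3
    rw [mul_smul, neg_smul, ← smul_neg, ← h4, inv_smul_smul₀ hk]

/-- A space of simple tensors in `ℂ² ⊗ M` is `ξ ⊗ S` for a vector `ξ` and a subspace `S`, or
`ℂ² ⊗ f` for a vector `f`. -/
theorem pure_submodule_cases {E : Submodule ℂ (M × M)} (hE : ∀ v ∈ E, IsPure v) :
    (∃ (a b : ℂ) (S : Submodule ℂ M), (a ≠ 0 ∨ b ≠ 0) ∧
      ∀ v, v ∈ E ↔ ∃ s ∈ S, v = (a • s, b • s)) ∨
    ∃ f : M, ∀ v, v ∈ E ↔ ∃ x y : ℂ, v = (x • f, y • f) := by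
  by_cases h : ∃ a b : ℂ, (a ≠ 0 ∨ b ≠ 0) ∧ ∀ v ∈ E, ∃ m : M, v = (a • m, b • m)
  · obtain ⟨a, b, hab, h⟩ := h
    refine Or.inl ⟨a, b, E.comap ((a • LinearMap.id).prod (b • LinearMap.id)), hab, fun v => ?_⟩
    constructor
    · intro hv
      obtain ⟨m, rfl⟩ := h v hv
      exact ⟨m, hv, rfl⟩
    · rintro ⟨s, hs, rfl⟩
      exact hs
  · push Not at h
    obtain ⟨v₀, hv₀, hv₀'⟩ := h 1 0 (Or.inl one_ne_zero)
    obtain ⟨a, b, f, rfl⟩ := hE v₀ hv₀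
    have hf : f ≠ 0 := fun h0 => hv₀' 0 (by simp [h0])
    have hab : a ≠ 0 ∨ b ≠ 0 := by
      by_contra hc
      push Not at hc
      exact hv₀' 0 (by simp [hc.1, hc.2])
    obtain ⟨v₁, hv₁, hv₁'⟩ := h a b hab
    obtain ⟨a', b', f', rfl⟩ := hE v₁ hv₁
    have hdet : a * b' - a' * b ≠ 0 := by
      intro h0
      obtain ⟨u, -, hu⟩ := exists_eq_smul_of_proportional (S := ⊤) hab
        (v := (a' • f', b' • f')) (by
          linear_combination (norm := module) congrArg (fun z => z • f') h0) trivial trivial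
      exact hv₁' u hu
    obtain ⟨c, rfl⟩ := exists_eq_smul_of_independent hE hv₀ hv₁ hdet hf
    have hc : c ≠ 0 := by
      rintro rfl
      exact hv₁' 0 (by simp)
    refine Or.inr ⟨f, fun v => ⟨fun hv => ?_, ?_⟩⟩
    · obtain ⟨p, q, g, rfl⟩ := hE v hv
      by_cases h0 : a * q - p * b = 0
      · by_cases h1 : a' * q - p * b' = 0
        · -- `(p, q)` is proportional to two linearly independent vectors, hence zero
          have hp : p = 0 := by
            refine (mul_eq_zero.1 ?_).resolve_right hdet
            linear_combination a' * h0 - a * h1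
          have hq : q = 0 := by
            refine (mul_eq_zero.1 ?_).resolve_right hdet
            linear_combination b' * h0 - b * h1
          exact ⟨0, 0, by simp [hp, hq]⟩
        · obtain ⟨k, rfl⟩ := exists_eq_smul_of_independent hE hv₁ hv h1 (smul_ne_zero hc hf)
          exact ⟨p * k * c, q * k * c, by simp only [mul_smul]⟩
      · obtain ⟨k, rfl⟩ := exists_eq_smul_of_independent hE hv₀ hv h0 hf
        exact ⟨p * k, q * k, by simp only [mul_smul]⟩
    · rintro ⟨x, y, rfl⟩
      have := E.add_mem
        (E.smul_mem ((a * b' - a' * b)⁻¹ * (x * b' - y * a')) hv₀)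
        (E.smul_mem ((a * b' - a' * b)⁻¹ * c⁻¹ * (y * a - x * b)) hv₁)
      convert this using 1
      ext
      · simp only [Prod.fst_add, Prod.smul_fst]
        match_scalars
        field_simp
        ring
      · simp only [Prod.snd_add, Prod.smul_snd]
        match_scalars
        field_simp
        ring

/-- The condition on `D` by which the pure tensors `ξ ⊗ s` of `D` are tied to its other elements: if
`d ∈ D` contracts to `s` along the functional annihilating `ξ = (a, b)` and `ξ ⊗ s ∈ D`, then
`ℂ² ⊗ s ⊆ D`. -/
def Saturated (D : Submodule ℂ (M × M)) : Prop :=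
  ∀ (a b : ℂ) (s : M), s ∈ D.map (contract (-b) a) → (a • s, b • s) ∈ D →
    (s, (0 : M)) ∈ D ∧ ((0 : M), s) ∈ D

open ComplexConjugate in
/-- For a saturated space `D` whose simple tensors form a subspace, there is a subspace `S` of `M`
such that modulo `ℂ² ⊗ S` there is no simple tensor in `D`, while in `ℂ² ⊗ S` the elements with all
contractions in those of `D` (or in the conjugate ones) are under control. -/
theorem Saturated.exists_submodule {D E : Submodule ℂ (M × M)} (hD : Saturated D)
    (hE : ∀ v, v ∈ E ↔ v ∈ D ∧ IsPure v) :
    ∃ S : Submodule ℂ M,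
      (∀ (x y : ℂ) (m : M), ∀ t ∈ S.prod S, (x • m, y • m) + t ∈ D → x • m ∈ S ∧ y • m ∈ S) ∧
      (∀ w ∈ S.prod S, (∀ α β, contract α β w ∈ D.map (contract α β)) → w ∈ D) ∧
      (∀ w ∈ S.prod S, (∀ α β, contract α β w ∈ D.map (contract (conj α) (conj β))) →
        ∃ (a b : ℂ) (m : M), w = (conj a • m, conj b • m) ∧ (a • m, b • m) ∈ D) := by
  rcases pure_submodule_cases fun v hv => ((hE v).1 hv).2 with ⟨a, b, S, hab, hS⟩ | ⟨f, hf⟩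
  · have hSD : ∀ s ∈ S, (a • s, b • s) ∈ D := fun s hs => ((hE _).1 ((hS _).2 ⟨s, hs, rfl⟩)).1
    have hpure : ∀ v ∈ D, IsPure v → ∃ s ∈ S, v = (a • s, b • s) := fun v hv hp =>
      (hS v).1 ((hE v).2 ⟨hv, hp⟩)
    have hzero : ∀ t ∈ S, t ∈ D.map (contract (-b) a) → t = 0 := by
      intro t ht htD
      obtain ⟨h1, h2⟩ := hD a b t htD (hSD t ht)
      obtain ⟨s, -, hs⟩ := hpure _ h1 ⟨1, 0, t, by simp⟩
      obtain ⟨s', -, hs'⟩ := hpure _ h2 ⟨0, 1, t, by simp⟩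
      simp only [Prod.mk.injEq] at hs hs'
      rcases hab with ha | hb
      · rw [hs'.2, (smul_eq_zero.1 hs'.1.symm).resolve_left ha, smul_zero]
      · rw [hs.1, (smul_eq_zero.1 hs.2.symm).resolve_left hb, smul_zero]
    refine ⟨S, ?_, ?_, ?_⟩
    · rintro x y m ⟨t₀, t₁⟩ ⟨ht₀, ht₁⟩ hd
      by_cases hδ : a * y - b * x = 0
      · have h1 : a • t₁ - b • t₀ = 0 := by
          refine hzero _ (S.sub_mem (S.smul_mem _ ht₁) (S.smul_mem _ ht₀)) ⟨_, hd, ?_⟩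
          simp only [contract_apply, Prod.fst_add, Prod.snd_add]
          linear_combination (norm := module) congrArg (fun z => z • m) hδ
        obtain ⟨u, -, hu⟩ := exists_eq_smul_of_proportional (S := ⊤) hab
          (v := (x • m, y • m) + (t₀, t₁)) (by
            simp only [Prod.fst_add, Prod.snd_add]
            linear_combination (norm := module) h1 + congrArg (fun z => z • m) hδ)
          trivial trivial
        rw [hu] at hd
        obtain ⟨s, hs, hsu⟩ := hpure _ hd (isPure_smul a b u)
        rw [hsu] at hu
        have e1 : x • m = a • s - t₀ := eq_sub_of_add_eq (congrArg Prod.fst hu)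
        have e2 : y • m = b • s - t₁ := eq_sub_of_add_eq (congrArg Prod.snd hu)
        rw [e1, e2]
        exact ⟨S.sub_mem (S.smul_mem _ hs) ht₀, S.sub_mem (S.smul_mem _ hs) ht₁⟩
      · -- decompose `t = (a, b) ⊗ t' + (x, y) ⊗ u`; the first summand lies in `D`
        set u : M := (a * y - b * x)⁻¹ • (a • t₁ - b • t₀) with hu
        set t' : M := (a * y - b * x)⁻¹ • (y • t₀ - x • t₁) with ht'
        have huS : u ∈ S :=
          S.smul_mem _ (S.sub_mem (S.smul_mem _ ht₁) (S.smul_mem _ ht₀))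
        have htS : t' ∈ S :=
          S.smul_mem _ (S.sub_mem (S.smul_mem _ ht₀) (S.smul_mem _ ht₁))
        have e0 : t₀ = a • t' + x • u := by
          rw [hu, ht']
          match_scalars <;> field_simp <;> ring
        have e1 : t₁ = b • t' + y • u := by
          rw [hu, ht']
          match_scalars <;> field_simp <;> ring
        have h1 : (x • (m + u), y • (m + u)) ∈ D := by
          convert D.sub_mem hd (hSD t' htS) using 1
          ext
          · simp only [Prod.fst_add, Prod.fst_sub]
            rw [e0]
            module
          · simp only [Prod.snd_add, Prod.snd_sub]
            rw [e1]
            module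
        obtain ⟨s, -, hs⟩ := hpure _ h1 (isPure_smul x y _)
        simp only [Prod.mk.injEq] at hs
        have h2 : (a * y - b * x) • (m + u) = 0 := by
          linear_combination (norm := module) a • hs.2 - b • hs.1
        have h3 : m = -u := eq_neg_of_add_eq_zero_left ((smul_eq_zero.1 h2).resolve_left hδ)
        rw [h3]
        exact ⟨S.smul_mem _ (S.neg_mem huS), S.smul_mem _ (S.neg_mem huS)⟩
    · rintro w ⟨hw₀, hw₁⟩ hw
      have h1 := hzero _ (S.add_mem (S.smul_mem _ hw₀) (S.smul_mem _ hw₁)) (hw (-b) a)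
      obtain ⟨u, hu, rfl⟩ := exists_eq_smul_of_proportional hab (v := w)
        (by linear_combination (norm := module) h1) hw₀ hw₁
      exact hSD u hu
    · rintro w ⟨hw₀, hw₁⟩ hw
      have h0 := hw (-conj b) (conj a)
      simp only [map_neg, Complex.conj_conj] at h0
      have h1 := hzero _ (S.add_mem (S.smul_mem _ hw₀) (S.smul_mem _ hw₁)) h0
      obtain ⟨u, hu, rfl⟩ := exists_eq_smul_of_proportional (a := conj a) (b := conj b)
        (by simpa using hab) (v := w) (by linear_combination (norm := module) h1) hw₀ hw₁
      exact ⟨a, b, u, rfl, hSD u hu⟩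
  · have hfD : ∀ x y : ℂ, (x • f, y • f) ∈ D := fun x y =>
      ((hE _).1 ((hf _).2 ⟨x, y, rfl⟩)).1
    have hSD : ∀ t ∈ (ℂ ∙ f).prod (ℂ ∙ f), t ∈ D := by
      rintro ⟨t₀, t₁⟩ ⟨h₀, h₁⟩
      obtain ⟨p, rfl⟩ := Submodule.mem_span_singleton.1 h₀
      obtain ⟨q, rfl⟩ := Submodule.mem_span_singleton.1 h₁
      exact hfD p q
    refine ⟨ℂ ∙ f, ?_, fun w hw _ => hSD w hw, ?_⟩
    · intro x y m t ht hd
      have h1 : (x • m, y • m) ∈ D := by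
        simpa using D.sub_mem hd (hSD t ht)
      obtain ⟨p, q, hpq⟩ := (hf _).1 ((hE _).2 ⟨h1, isPure_smul x y m⟩)
      simp only [Prod.mk.injEq] at hpq
      rw [hpq.1, hpq.2]
      exact ⟨Submodule.smul_mem _ _ (Submodule.mem_span_singleton_self f),
        Submodule.smul_mem _ _ (Submodule.mem_span_singleton_self f)⟩
    · rintro ⟨t₀, t₁⟩ ⟨h₀, h₁⟩ -
      obtain ⟨p, rfl⟩ := Submodule.mem_span_singleton.1 h₀
      obtain ⟨q, rfl⟩ := Submodule.mem_span_singleton.1 h₁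
      exact ⟨conj p, conj q, f, by simp, hfD _ _⟩

/-- The image of `D` in `ℂ² ⊗ (M ⧸ S)`. -/
def modOut (S : Submodule ℂ M) (D : Submodule ℂ (M × M)) : Submodule ℂ ((M ⧸ S) × (M ⧸ S)) :=
  D.map (S.mkQ.prodMap S.mkQ)

theorem eq_zero_of_isPure_of_mem_modOut {S : Submodule ℂ M} {D : Submodule ℂ (M × M)}
    (hS : ∀ (x y : ℂ) (m : M), ∀ t ∈ S.prod S, (x • m, y • m) + t ∈ D → x • m ∈ S ∧ y • m ∈ S) :
    ∀ v ∈ modOut S D, IsPure v → v = 0 := by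
  rintro v ⟨d, hd, hdv⟩ ⟨x, y, m', rfl⟩
  obtain ⟨m, rfl⟩ := S.mkQ_surjective m'
  have h1 : S.mkQ d.1 = S.mkQ (x • m) := by simpa using congrArg Prod.fst hdv
  have h2 : S.mkQ d.2 = S.mkQ (y • m) := by simpa using congrArg Prod.snd hdv
  have h := hS x y m (d - (x • m, y • m))
    ⟨(Submodule.Quotient.eq S).1 h1, (Submodule.Quotient.eq S).1 h2⟩ (by simpa using hd)
  ext
  · exact (S.mkQ.map_smul x m).symm.trans ((Submodule.Quotient.mk_eq_zero S).2 h.1)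
  · exact (S.mkQ.map_smul y m).symm.trans ((Submodule.Quotient.mk_eq_zero S).2 h.2)

theorem contract_mkQ_mem {S : Submodule ℂ M} {D : Submodule ℂ (M × M)} {α β α' β' : ℂ} {w : M × M}
    (hw : contract α β w ∈ D.map (contract α' β')) :
    contract α β (S.mkQ.prodMap S.mkQ w) ∈ (modOut S D).map (contract α' β') := by
  obtain ⟨d, hd, hdw⟩ := hw
  refine ⟨_, Submodule.mem_map_of_mem hd, ?_⟩
  simpa [contract_apply] using congrArg S.mkQ hdw

/-- An element all of whose contractions are contractions of elements of `D` lies in `D`. -/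
theorem Saturated.mem_of_contract_mem [FiniteDimensional ℂ M] {D E : Submodule ℂ (M × M)}
    (hD : Saturated D) (hE : ∀ v, v ∈ E ↔ v ∈ D ∧ IsPure v) {w : M × M}
    (hw : ∀ α β, contract α β w ∈ D.map (contract α β)) : w ∈ D := by
  obtain ⟨S, h1, h2, -⟩ := hD.exists_submodule hE
  obtain ⟨d, hd, hdw⟩ := Decomp.mem_of_contract_mem (eq_zero_of_isPure_of_mem_modOut h1)
    Set.infinite_univ fun μ _ => contract_mkQ_mem (S := S) (hw 1 μ)
  have h3 : w - d ∈ S.prod S := by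
    constructor
    · exact (Submodule.Quotient.eq S).1 (by simpa using (congrArg Prod.fst hdw).symm)
    · exact (Submodule.Quotient.eq S).1 (by simpa using (congrArg Prod.snd hdw).symm)
  have h4 : w - d ∈ D := h2 _ h3 fun α β => by
    rw [map_sub]
    exact Submodule.sub_mem _ (hw α β) (Submodule.mem_map_of_mem hd)
  simpa using D.add_mem h4 hd

open ComplexConjugate in
/-- An element all of whose contractions are conjugate contractions of elements of `D` is the
partial conjugate of a simple tensor in `D`. -/
theorem Saturated.exists_of_contract_mem_conj [FiniteDimensional ℂ M] {D E : Submodule ℂ (M × M)}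
    (hD : Saturated D) (hE : ∀ v, v ∈ E ↔ v ∈ D ∧ IsPure v) {w : M × M}
    (hw : ∀ α β, contract α β w ∈ D.map (contract (conj α) (conj β))) :
    ∃ (a b : ℂ) (m : M), w = (conj a • m, conj b • m) ∧ (a • m, b • m) ∈ D := by
  obtain ⟨S, h1, -, h2⟩ := hD.exists_submodule hE
  have h3 := eq_zero_of_contract_mem_conj (eq_zero_of_isPure_of_mem_modOut h1)
    fun α β => contract_mkQ_mem (S := S) (hw α β)
  refine h2 w ⟨?_, ?_⟩ hw
  · simpa using congrArg Prod.fst h3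
  · simpa using congrArg Prod.snd h3

open ComplexConjugate in
/-- If the partial conjugates of the simple tensors of `D` are the elements of a subspace, then so are
the simple tensors of `D` themselves. -/
theorem exists_submodule_of_conj {D E : Submodule ℂ (M × M)} (hE : ∀ v ∈ E, IsPure v)
    (hDE : ∀ (x y : ℂ) (m : M), (x • m, y • m) ∈ E ↔ (conj x • m, conj y • m) ∈ D) :
    ∃ P : Submodule ℂ (M × M), ∀ v, v ∈ P ↔ v ∈ D ∧ IsPure v := by
  have hDE' : ∀ (x y : ℂ) (m : M), (x • m, y • m) ∈ D ↔ (conj x • m, conj y • m) ∈ E := by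
    intro x y m
    simpa using (hDE (conj x) (conj y) m).symm
  rcases pure_submodule_cases hE with ⟨a, b, S, hab, hS⟩ | ⟨f, hf⟩
  · refine ⟨S.map ((conj a • LinearMap.id).prod (conj b • LinearMap.id)), fun v => ⟨?_, ?_⟩⟩
    · rintro ⟨s, hs, rfl⟩
      exact ⟨(hDE a b s).1 ((hS _).2 ⟨s, hs, rfl⟩), conj a, conj b, s, rfl⟩
    · rintro ⟨hv, x, y, m, rfl⟩
      obtain ⟨s, hs, hs'⟩ := (hS _).1 ((hDE' x y m).1 hv)
      simp only [Prod.mk.injEq] at hs'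
      -- unless the element vanishes, `(x, y)` is proportional to the conjugate of `(a, b)`
      have hx : (conj x * b - conj y * a) • m = 0 := by
        linear_combination (norm := module) b • hs'.1 - a • hs'.2
      have hxy : conj a • y • m = conj b • x • m := by
        rcases smul_eq_zero.1 hx with h | h
        · have h' := congrArg conj h
          simp only [map_sub, map_mul, Complex.conj_conj, map_zero] at h'
          linear_combination (norm := module) -congrArg (fun z => z • m) h'
        · rw [h]; simp
      have hmem : ∀ c : ℂ, ∀ c' : ℂ, conj c • m = c' • s → c • m ∈ S := by
        intro c c' h
        by_cases hc : c = 0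
        · rw [hc, zero_smul]; exact S.zero_mem
        · have hc' : conj c ≠ 0 := by simpa using hc
          have : m = (conj c)⁻¹ • c' • s := by rw [← h, inv_smul_smul₀ hc']
          rw [this]
          exact S.smul_mem _ (S.smul_mem _ (S.smul_mem _ hs))
      obtain ⟨u, hu, huv⟩ := exists_eq_smul_of_proportional (a := conj a) (b := conj b)
        (by simpa using hab) (v := (x • m, y • m)) hxy (hmem x a hs'.1) (hmem y b hs'.2)
      exact ⟨u, hu, huv.symm⟩
  · refine ⟨E, fun v => ⟨fun hv => ⟨?_, hE v hv⟩, ?_⟩⟩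
    · obtain ⟨x, y, rfl⟩ := (hf v).1 hv
      exact (hDE' x y f).2 ((hf _).2 ⟨_, _, rfl⟩)
    · rintro ⟨hv, x, y, m, rfl⟩
      obtain ⟨p, q, hpq⟩ := (hf _).1 ((hDE' x y m).1 hv)
      simp only [Prod.mk.injEq] at hpq
      have hmem : ∀ c p : ℂ, conj c • m = p • f → ∃ p' : ℂ, c • m = p' • f := by
        intro c p h
        by_cases hc : c = 0
        · exact ⟨0, by simp [hc]⟩
        · have hc' : conj c ≠ 0 := by simpa using hc
          refine ⟨c * (conj c)⁻¹ * p, ?_⟩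
          rw [mul_smul, ← h, smul_smul, mul_assoc, inv_mul_cancel₀ hc', mul_one]
      obtain ⟨p', hp'⟩ := hmem x p hpq.1
      obtain ⟨q', hq'⟩ := hmem y q hpq.2
      exact (hf _).2 ⟨p', q', by rw [hp', hq']⟩

/-- If every element whose contractions are contractions of elements of `D` lies in `D`, then `D` is
saturated. -/
theorem saturated_of_contract_closed {D : Submodule ℂ (M × M)}
    (hD : ∀ w : M × M, (∀ α β, contract α β w ∈ D.map (contract α β)) → w ∈ D) :
    Saturated D := by
  rintro a b s ⟨d, hd, hds⟩ hs
  simp only [contract_apply] at hds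
  -- both elements are covered by `(a, b) ⊗ s`, except along the functional annihilating `(a, b)`,
  -- where a multiple of `d` takes over
  have key : ∀ α β : ℂ, s ∈ D.map (contract α β) ∨ α * a + β * b = 0 := by
    intro α β
    by_cases h : α * a + β * b = 0
    · exact Or.inr h
    · refine Or.inl ((Submodule.smul_mem_iff _ h).1 ⟨_, hs, ?_⟩)
      simp only [contract_apply]
      module
  by_cases hab : a = 0 ∧ b = 0
  · have : s = 0 := by rw [← hds, hab.1, hab.2]; simp
    subst this
    exact ⟨D.zero_mem, D.zero_mem⟩
  have hpar : ∀ α β : ℂ, α * a + β * b = 0 → ∃ c : ℂ, α = c * -b ∧ β = c * a := by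
    intro α β h
    by_cases ha : a = 0
    · have hb : b ≠ 0 := fun hb => hab ⟨ha, hb⟩
      have hβ : β = 0 := by
        rw [ha, mul_zero, zero_add] at h
        exact (mul_eq_zero.1 h).resolve_right hb
      exact ⟨-α / b, by field_simp, by rw [hβ, ha, mul_zero]⟩
    · refine ⟨β / a, ?_, by field_simp⟩
      field_simp
      linear_combination h
  constructor
  · refine hD _ fun α β => ?_
    have h0 : contract α β (s, (0 : M)) = α • s := by simp [contract_apply]
    rw [h0]
    rcases key α β with h | h
    · exact Submodule.smul_mem _ _ h
    · obtain ⟨c, rfl, rfl⟩ := hpar α β h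
      refine ⟨-b • d, D.smul_mem _ hd, ?_⟩
      simp only [contract_apply, Prod.smul_fst, Prod.smul_snd]
      linear_combination (norm := module) (c * -b) • hds
  · refine hD _ fun α β => ?_
    have h0 : contract α β ((0 : M), s) = β • s := by simp [contract_apply]
    rw [h0]
    rcases key α β with h | h
    · exact Submodule.smul_mem _ _ h
    · obtain ⟨c, rfl, rfl⟩ := hpar α β h
      refine ⟨a • d, D.smul_mem _ hd, ?_⟩
      simp only [contract_apply, Prod.smul_fst, Prod.smul_snd]
      linear_combination (norm := module) (c * a) • hds

end Structure

/-! ### Orthogonality for the trace form -/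

section Trace

variable {m n : ℕ}

theorem trace_conjTranspose_mul (U V : Mat m n) :
    Matrix.trace (U.conjTranspose * V) = ∑ i, ∑ j, star (U i j) * V i j := by
  simp only [Matrix.trace, Matrix.diag, Matrix.mul_apply, Matrix.conjTranspose_apply]
  exact Finset.sum_comm

theorem trace_conjTranspose_mul_eq_star (U V : Mat m n) :
    Matrix.trace (U.conjTranspose * V) = star (Matrix.trace (V.conjTranspose * U)) := by
  rw [← Matrix.trace_conjTranspose, Matrix.conjTranspose_mul, Matrix.conjTranspose_conjTranspose]

theorem exists_mem_orthCompl_of_notMem {D : Submodule ℂ (Mat m n)} {V : Mat m n} (hV : V ∉ D) :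
    ∃ U ∈ orthCompl D, Matrix.trace (U.conjTranspose * V) ≠ 0 := by
  obtain ⟨f, hfV, hfD⟩ := Submodule.exists_le_ker_of_notMem hV
  have key : ∀ X, Matrix.trace ((Matrix.of fun i j => star (f (Matrix.single i j 1)) :
      Mat m n).conjTranspose * X) = f X := by
    intro X
    rw [trace_conjTranspose_mul]
    conv_rhs => rw [Matrix.matrix_eq_sum_single X]
    simp only [map_sum, Matrix.of_apply, star_star]
    refine Finset.sum_congr rfl fun i _ => Finset.sum_congr rfl fun j _ => ?_
    have : Matrix.single i j (X i j) = X i j • Matrix.single i j (1 : ℂ) := by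
      rw [Matrix.smul_single, smul_eq_mul, mul_one]
    rw [this, map_smul, smul_eq_mul, mul_comm]
  refine ⟨_, fun X hX => ?_, (key V).trans_ne hfV⟩
  rw [trace_conjTranspose_mul_eq_star, key, LinearMap.mem_ker.1 (hfD hX), star_zero]

theorem exists_dotProduct_ne_zero_of_notMem {R : Submodule ℂ (Fin n → ℂ)} {y : Fin n → ℂ}
    (hy : y ∉ R) : ∃ η : Fin n → ℂ, y ⬝ᵥ η ≠ 0 ∧ ∀ r ∈ R, r ⬝ᵥ η = 0 := by
  obtain ⟨f, hfy, hfR⟩ := Submodule.exists_le_ker_of_notMem hy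
  have key : ∀ x, x ⬝ᵥ (fun i => f (Pi.single i 1)) = f x := by
    intro x
    rw [LinearMap.pi_apply_eq_sum_univ f x]
    simp only [dotProduct, smul_eq_mul]
    refine Finset.sum_congr rfl fun i _ => ?_
    congr 2
    ext j
    simp [Pi.single_apply, eq_comm]
  exact ⟨_, (key y).trans_ne hfy, fun r hr => (key r).trans (LinearMap.mem_ker.1 (hfR hr))⟩

end Trace

/-! ### Matrices with two rows as elements of `ℂ² ⊗ ℂⁿ` -/

section Rows

variable {n : ℕ}

/-- A `2 × n` matrix as the pair of its rows, that is, as an element of `ℂ² ⊗ ℂⁿ`. -/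
def rows (n : ℕ) : Mat 2 n ≃ₗ[ℂ] (Fin n → ℂ) × (Fin n → ℂ) where
  toFun V := (V 0, V 1)
  invFun v := Matrix.of ![v.1, v.2]
  map_add' _ _ := rfl
  map_smul' _ _ := rfl
  left_inv V := by
    ext i j
    fin_cases i <;> rfl
  right_inv v := rfl

theorem rows_apply (V : Mat 2 n) : rows n V = (V 0, V 1) := rfl

/-- The subspace `D` of `ℂ² ⊗ ℂⁿ`, in terms of pairs of rows. -/
abbrev rowSpace (D : Submodule ℂ (Mat 2 n)) : Submodule ℂ ((Fin n → ℂ) × (Fin n → ℂ)) :=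
  D.map (rows n).toLinearMap

theorem rows_mem_rowSpace {D : Submodule ℂ (Mat 2 n)} {V : Mat 2 n} :
    rows n V ∈ rowSpace D ↔ V ∈ D :=
  ⟨fun ⟨_, hU, h⟩ => (rows n).injective h ▸ hU, fun h => ⟨V, h, rfl⟩⟩

theorem rows_vecMulVec (ξ : Fin 2 → ℂ) (m : Fin n → ℂ) :
    rows n (Matrix.vecMulVec ξ m) = (ξ 0 • m, ξ 1 • m) := rfl

theorem smul_mem_rowSpace {D : Submodule ℂ (Mat 2 n)} {a b : ℂ} {m : Fin n → ℂ} :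
    (a • m, b • m) ∈ rowSpace D ↔ Matrix.vecMulVec ![a, b] m ∈ D := by
  rw [← rows_mem_rowSpace, rows_vecMulVec]
  rfl

theorem isProductVector_vecMulVec (ξ : Fin 2 → ℂ) (m : Fin n → ℂ) :
    IsProductVector (Matrix.vecMulVec ξ m) := ⟨ξ, star m, by rw [star_star]⟩

theorem isPure_rows_iff {V : Mat 2 n} : IsPure (rows n V) ↔ IsProductVector V := by
  constructor
  · rintro ⟨a, b, m, h⟩
    have : V = Matrix.vecMulVec ![a, b] m := (rows n).injective h
    rw [this]
    exact isProductVector_vecMulVec _ _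
  · rintro ⟨ξ, η, rfl⟩
    exact ⟨_, _, _, rows_vecMulVec _ _⟩

theorem trace_vecMulVec_conjTranspose_mul (ξ : Fin 2 → ℂ) (m : Fin n → ℂ) (V : Mat 2 n) :
    Matrix.trace ((Matrix.vecMulVec ξ m).conjTranspose * V) =
      contract (star (ξ 0)) (star (ξ 1)) (rows n V) ⬝ᵥ star m := by
  rw [trace_conjTranspose_mul, Fin.sum_univ_two, ← Finset.sum_add_distrib]
  simp only [dotProduct, contract_apply, rows_apply, Matrix.vecMulVec_apply, Pi.add_apply,
    Pi.smul_apply, smul_eq_mul, star_mul', Pi.star_apply]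
  exact Finset.sum_congr rfl fun i _ => by ring

/-- The elements whose contractions are contractions of elements of `D` are those orthogonal to
all product vectors of `D^⊥`. -/
theorem contract_mem_iff_forall_trace_eq_zero {D : Submodule ℂ (Mat 2 n)} {W : Mat 2 n} :
    (∀ α β, contract α β (rows n W) ∈ (rowSpace D).map (contract α β)) ↔
      ∀ Z ∈ orthCompl D, IsProductVector Z → Matrix.trace (Z.conjTranspose * W) = 0 := by
  constructor
  · rintro h _ hZ ⟨ξ, η, rfl⟩
    obtain ⟨_, ⟨V, hV, rfl⟩, hd⟩ := h (star (ξ 0)) (star (ξ 1))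
    rw [trace_vecMulVec_conjTranspose_mul, ← hd]
    change contract _ _ (rows n V) ⬝ᵥ _ = 0
    rw [← trace_vecMulVec_conjTranspose_mul, trace_conjTranspose_mul_eq_star, hZ V hV, star_zero]
  · intro h α β
    by_contra hc
    obtain ⟨η, h1, h2⟩ := exists_dotProduct_ne_zero_of_notMem hc
    refine h1 ?_
    have h3 := h (Matrix.vecMulVec ![star α, star β] (star η)) (fun V hV => ?_)
      (isProductVector_vecMulVec _ _)
    · rw [trace_vecMulVec_conjTranspose_mul] at h3
      simpa using h3
    · have h4 := h2 _ (Submodule.mem_map_of_mem (rows_mem_rowSpace.2 hV))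
      rw [trace_conjTranspose_mul_eq_star, trace_vecMulVec_conjTranspose_mul]
      simpa using h4

open ComplexConjugate in
/-- An element orthogonal to the partial conjugates of the product vectors of `D^⊥` has its
contractions among the conjugate contractions of elements of `D`. -/
theorem contract_mem_conj_of_forall_trace_eq_zero {D : Submodule ℂ (Mat 2 n)} {W : Mat 2 n}
    (hW : ∀ (ξ : Fin 2 → ℂ) (m : Fin n → ℂ), Matrix.vecMulVec ξ m ∈ orthCompl D →
      Matrix.trace ((Matrix.vecMulVec (star ξ) m).conjTranspose * W) = 0) (α β : ℂ) :
    contract α β (rows n W) ∈ (rowSpace D).map (contract (conj α) (conj β)) := by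
  by_contra hc
  obtain ⟨η, h1, h2⟩ := exists_dotProduct_ne_zero_of_notMem hc
  refine h1 ?_
  have h3 := hW ![α, β] (star η) fun V hV => ?_
  · rw [trace_vecMulVec_conjTranspose_mul] at h3
    simpa using h3
  · have h4 := h2 _ (Submodule.mem_map_of_mem (rows_mem_rowSpace.2 hV))
    rw [trace_conjTranspose_mul_eq_star, trace_vecMulVec_conjTranspose_mul]
    simpa using h4

/-- `D^⊥` is spanned by product vectors if and only if every element whose contractions are
contractions of elements of `D` lies in `D`. -/
theorem span_productVectors_eq_orthCompl_iff {D : Submodule ℂ (Mat 2 n)} :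
    Submodule.span ℂ {W | W ∈ orthCompl D ∧ IsProductVector W} = orthCompl D ↔
      ∀ w, (∀ α β, contract α β w ∈ (rowSpace D).map (contract α β)) → w ∈ rowSpace D := by
  constructor
  · intro h w hw
    obtain ⟨W, rfl⟩ := (rows n).surjective w
    rw [contract_mem_iff_forall_trace_eq_zero] at hw
    rw [rows_mem_rowSpace]
    by_contra hc
    obtain ⟨U, hU, hUW⟩ := exists_mem_orthCompl_of_notMem hc
    rw [← h] at hU
    refine hUW ?_
    have h1 : Submodule.span ℂ {Z | Z ∈ orthCompl D ∧ IsProductVector Z} ≤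
        orthCompl (Submodule.span ℂ {W}) := by
      refine Submodule.span_le.2 ?_
      rintro Z ⟨hZ, hZ'⟩ V hV
      obtain ⟨c, rfl⟩ := Submodule.mem_span_singleton.1 hV
      rw [trace_conjTranspose_mul_eq_star, Matrix.mul_smul, Matrix.trace_smul, hw Z hZ hZ',
        smul_zero, star_zero]
    rw [trace_conjTranspose_mul_eq_star, h1 hU W (Submodule.mem_span_singleton_self W), star_zero]
  · intro h
    refine le_antisymm (Submodule.span_le.2 fun W hW => hW.1) fun U hU => ?_
    by_contra hc
    obtain ⟨W, hW, hWU⟩ := exists_mem_orthCompl_of_notMem hc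
    have h1 : W ∈ D := by
      rw [← rows_mem_rowSpace]
      refine h _ (contract_mem_iff_forall_trace_eq_zero.2 fun Z hZ hZ' => ?_)
      exact hW Z (Submodule.subset_span ⟨hZ, hZ'⟩)
    exact hWU (hU W h1)

/-- The product vectors of `D` form a subspace if and only if the simple tensors of its row space
do. -/
theorem exists_submodule_productVectors_iff {D : Submodule ℂ (Mat 2 n)} :
    (∃ D₁ : Submodule ℂ (Mat 2 n), (D₁ : Set (Mat 2 n)) = {V | V ∈ D ∧ IsProductVector V}) ↔
      ∃ P : Submodule ℂ ((Fin n → ℂ) × (Fin n → ℂ)),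
        ∀ v, v ∈ P ↔ v ∈ rowSpace D ∧ IsPure v := by
  constructor
  · rintro ⟨D₁, h⟩
    refine ⟨rowSpace D₁, fun v => ?_⟩
    obtain ⟨V, rfl⟩ := (rows n).surjective v
    rw [rows_mem_rowSpace, rows_mem_rowSpace, isPure_rows_iff]
    exact Set.ext_iff.1 h V
  · rintro ⟨P, h⟩
    refine ⟨P.comap (rows n).toLinearMap, Set.ext fun V => ?_⟩
    have := h (rows n V)
    rw [rows_mem_rowSpace, isPure_rows_iff] at this
    exact this

end Rows

/-! ### Elementary maps, Kraus decompositions and cross terms -/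

section Maps

variable {m n : ℕ}

theorem elemMap_apply (V : Mat m n) (X : Mat m m) : elemMap V X = V.conjTranspose * X * V := rfl

theorem comp_transposeMap_apply (φ : MapSpace m n) (X : Mat m m) :
    (φ ∘ₗ transposeMap m) X = φ X.transpose := rfl

theorem comp_transposeMap_comp_transposeMap (φ : MapSpace m n) :
    (φ ∘ₗ transposeMap m) ∘ₗ transposeMap m = φ := by
  ext1 X
  rw [comp_transposeMap_apply, comp_transposeMap_apply, Matrix.transpose_transpose]

theorem isCP_elemMap (V : Mat m n) : IsCP (elemMap V) := by
  intro k X hX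
  let B : Matrix (Fin k × Fin m) (Fin k × Fin n) ℂ :=
    Matrix.comp _ _ _ _ _ (Matrix.diagonal fun _ => V)
  convert hX.conjTranspose_mul_mul_same B using 1
  ext ⟨i, a⟩ ⟨j, b⟩
  simp only [Matrix.comp_apply, Matrix.map_apply, elemMap_apply, Matrix.mul_apply,
    Matrix.conjTranspose_apply, Fintype.sum_prod_type, B]
  rw [Finset.sum_eq_single j]
  · refine Finset.sum_congr rfl fun q _ => ?_
    rw [Matrix.diagonal_apply_eq, Finset.sum_eq_single i]
    · simp only [Matrix.diagonal_apply_eq]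
    · intro i' _ hi'
      simp [Matrix.diagonal_apply_ne _ hi']
    · simp
  · intro j' _ hj'
    simp [Matrix.diagonal_apply_ne _ hj']
  · simp

theorem isCCP_elemMap_comp_transposeMap (V : Mat m n) : IsCCP (elemMap V ∘ₗ transposeMap m) := by
  rw [IsCCP, comp_transposeMap_comp_transposeMap]
  exact isCP_elemMap V

theorem elemMap_single_apply (V : Mat m n) (p q : Fin m) (a b : Fin n) :
    elemMap V (Matrix.single p q 1) a b = star (V p a) * V q b := by
  simp [elemMap_apply, Matrix.mul_apply, Matrix.single_apply, ite_and]

theorem mapSpace_ext {φ ψ : MapSpace m n}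
    (h : ∀ p q a b, φ (Matrix.single p q 1) a b = ψ (Matrix.single p q 1) a b) : φ = ψ := by
  refine Matrix.ext_linearMap ℂ fun p q => ?_
  ext a b
  exact h p q a b

open scoped MatrixOrder in
/-- Choi–Kraus decomposition: the block matrix `[φ(e_{pq})]` of a completely positive map is
positive semidefinite, and the rows of a square root of it are the Kraus operators. -/
theorem IsCP.exists_eq_sum_elemMap {φ : MapSpace m n} (hφ : IsCP φ) :
    ∃ (ι : Type) (_ : Fintype ι) (V : ι → Mat m n), φ = ∑ i, elemMap (V i) := by
  -- the block matrix `[e_{pq}]` is a multiple of a projection onto a maximally entangled vector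
  have h1 : (Matrix.comp _ _ _ _ _ (Matrix.of fun p q : Fin m =>
      (Matrix.single p q 1 : Mat m m))).PosSemidef := by
    convert Matrix.posSemidef_vecMulVec_star_self
      (fun x : Fin m × Fin m => if x.1 = x.2 then (1 : ℂ) else 0) using 1
    ext ⟨p, a⟩ ⟨q, b⟩
    simp only [Matrix.comp_apply, Matrix.of_apply, Matrix.single_apply, Matrix.vecMulVec_apply,
      Pi.star_apply, apply_ite star, star_one, star_zero, ite_and]
    split_ifs <;> simp
  obtain ⟨B, hB⟩ := CStarAlgebra.nonneg_iff_eq_star_mul_self.mp (hφ m _ h1).nonneg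
  refine ⟨Fin m × Fin n, inferInstance, fun i => Matrix.of fun p a => B i (p, a),
    mapSpace_ext fun p q a b => ?_⟩
  have h2 := congrFun (congrFun hB (p, a)) (q, b)
  rw [LinearMap.sum_apply, Matrix.sum_apply]
  simp only [elemMap_single_apply, Matrix.of_apply]
  exact h2

theorem isCCP_exists_eq_sum_elemMap {φ : MapSpace m n} (hφ : IsCCP φ) :
    ∃ (ι : Type) (_ : Fintype ι) (V : ι → Mat m n),
      φ = ∑ i, elemMap (V i) ∘ₗ transposeMap m := by
  obtain ⟨ι, hι, V, h⟩ := IsCP.exists_eq_sum_elemMap hφ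
  refine ⟨ι, hι, V, ?_⟩
  rw [← comp_transposeMap_comp_transposeMap φ, h]
  ext1 X
  simp [LinearMap.sum_apply]

theorem elemMap_mem_faceOf {D : Submodule ℂ (Mat m n)} {V : Mat m n} (hV : V ∈ D) :
    elemMap V ∈ faceOf D := ⟨1, fun _ => V, fun _ => hV, by simp⟩

theorem isCP_of_mem_faceOf {D : Submodule ℂ (Mat m n)} {φ : MapSpace m n} (hφ : φ ∈ faceOf D) :
    IsCP φ := by
  obtain ⟨k, V, -, rfl⟩ := hφ
  exact (cpCone m n).sum_mem fun i _ => isCP_elemMap (V i)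

theorem mem_decCone_of_isCP {φ : MapSpace m n} (hφ : IsCP φ) : φ ∈ decCone m n :=
  mem_decCone.2 ⟨φ, hφ, 0, (ccpCone m n).zero_mem, add_zero φ⟩

theorem mem_decCone_of_isCCP {φ : MapSpace m n} (hφ : IsCCP φ) : φ ∈ decCone m n :=
  mem_decCone.2 ⟨0, IsCP.zero, φ, hφ, zero_add φ⟩

theorem faceOf_le_decCone (D : Submodule ℂ (Mat m n)) : faceOf D ≤ decCone m n :=
  fun _ hφ => mem_decCone_of_isCP (isCP_of_mem_faceOf hφ)

/-- The value of the Choi matrix of `X ↦ V* X V` at a vector `U` is `|(U | V)|²`. -/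
theorem normSq_trace_eq_sum_elemMap (U V : Mat m n) :
    ∑ p, ∑ q, ∑ a, ∑ b, U p a * elemMap V (Matrix.single p q 1) a b * star (U q b) =
      Complex.normSq (Matrix.trace (U.conjTranspose * V)) := by
  rw [Complex.normSq_eq_conj_mul_self, ← Complex.star_def, ← trace_conjTranspose_mul_eq_star,
    trace_conjTranspose_mul, trace_conjTranspose_mul, Finset.sum_mul_sum]
  refine Finset.sum_congr rfl fun p _ => Finset.sum_congr rfl fun q _ => ?_
  rw [Finset.sum_mul_sum]
  refine Finset.sum_congr rfl fun a _ => Finset.sum_congr rfl fun b _ => ?_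
  rw [elemMap_single_apply]
  ring

/-- `D` can be recovered from `Φ_D`, since `V` lies in the span of the operators of any Kraus
decomposition of `X ↦ V* X V`. -/
theorem elemMap_mem_faceOf_iff {D : Submodule ℂ (Mat m n)} {V : Mat m n} :
    elemMap V ∈ faceOf D ↔ V ∈ D := by
  refine ⟨?_, elemMap_mem_faceOf⟩
  rintro ⟨k, W, hW, h⟩
  by_contra hV
  obtain ⟨U, hU, hUV⟩ := exists_mem_orthCompl_of_notMem hV
  have h1 := normSq_trace_eq_sum_elemMap U V
  have h2 : ∑ p, ∑ q, ∑ a, ∑ b, U p a * elemMap V (Matrix.single p q 1) a b * star (U q b) =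
      ∑ i, ∑ p, ∑ q, ∑ a, ∑ b,
        U p a * elemMap (W i) (Matrix.single p q 1) a b * star (U q b) := by
    symm
    rw [Finset.sum_comm]
    refine Finset.sum_congr rfl fun p _ => ?_
    rw [Finset.sum_comm]
    refine Finset.sum_congr rfl fun q _ => ?_
    rw [Finset.sum_comm]
    refine Finset.sum_congr rfl fun a _ => ?_
    rw [Finset.sum_comm]
    refine Finset.sum_congr rfl fun b _ => ?_
    rw [h, LinearMap.sum_apply, Matrix.sum_apply, Finset.mul_sum, Finset.sum_mul]
  rw [h2] at h1
  have h3 : ∀ i, Matrix.trace (U.conjTranspose * W i) = 0 := fun i => by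
    rw [trace_conjTranspose_mul_eq_star, hU _ (hW i), star_zero]
  simp only [normSq_trace_eq_sum_elemMap, h3, map_zero, Complex.ofReal_zero,
    Finset.sum_const_zero] at h1
  exact hUV (Complex.normSq_eq_zero.1 (by exact_mod_cast h1.symm))

/-- The polarization `X ↦ V* X U + U* X V` of `V ↦ elemMap V`. -/
def crossMap (V U : Mat m n) : MapSpace m n where
  toFun X := V.conjTranspose * X * U + U.conjTranspose * X * V
  map_add' X Y := by
    simp only [Matrix.mul_add, Matrix.add_mul]
    abel
  map_smul' c X := by
    simp only [Matrix.mul_smul, Matrix.smul_mul, RingHom.id_apply, smul_add]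

theorem crossMap_apply (V U : Mat m n) (X : Mat m m) :
    crossMap V U X = V.conjTranspose * X * U + U.conjTranspose * X * V := rfl

theorem elemMap_add (V U : Mat m n) :
    elemMap (V + U) = elemMap V + elemMap U + crossMap V U := by
  ext1 X
  simp only [elemMap_apply, LinearMap.add_apply, crossMap_apply, Matrix.conjTranspose_add,
    Matrix.mul_add, Matrix.add_mul]
  abel

theorem elemMap_smul (c : ℂ) (V : Mat m n) : elemMap (c • V) = Complex.normSq c • elemMap V := by
  refine LinearMap.ext fun X => ?_
  change (c • V).conjTranspose * X * (c • V) = Complex.normSq c • (V.conjTranspose * X * V)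
  rw [Matrix.conjTranspose_smul, Matrix.smul_mul, Matrix.smul_mul, Matrix.mul_smul, smul_smul,
    Complex.star_def, ← Complex.normSq_eq_conj_mul_self, Complex.coe_smul]

theorem crossMap_ofReal_smul (r : ℝ) (V U : Mat m n) :
    crossMap V ((r : ℂ) • U) = r • crossMap V U := by
  refine LinearMap.ext fun X => ?_
  change V.conjTranspose * X * ((r : ℂ) • U) + ((r : ℂ) • U).conjTranspose * X * V =
    r • (V.conjTranspose * X * U + U.conjTranspose * X * V)
  rw [Matrix.conjTranspose_smul, Complex.star_def, Complex.conj_ofReal, Matrix.smul_mul,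
    Matrix.smul_mul, Matrix.mul_smul, ← smul_add, Complex.coe_smul]

/-- The kernel of a positive semidefinite form, in its quadratic version: the cross terms with a
null vector vanish. -/
theorem apply_crossMap_eq_zero {L : MapSpace m n →ₗ[ℝ] ℝ} (hL : ∀ V, 0 ≤ L (elemMap V))
    {U : Mat m n} (hU : L (elemMap U) = 0) (V : Mat m n) : L (crossMap V U) = 0 := by
  have key : ∀ r : ℝ, 0 ≤ L (elemMap V) + r * L (crossMap V U) := by
    intro r
    have := hL (V + (r : ℂ) • U)
    rw [elemMap_add, elemMap_smul, crossMap_ofReal_smul, map_add, map_add, map_smul, map_smul, hU,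
      smul_zero, add_zero] at this
    exact this
  by_contra h
  have h1 := key (-(L (elemMap V) + 1) / L (crossMap V U))
  rw [div_mul_cancel₀ _ h] at h1
  linarith

/-- The matrices `V` for which `L` vanishes on `X ↦ V* X V`. -/
def nullSpace (L : MapSpace m n →ₗ[ℝ] ℝ) (hL : ∀ V, 0 ≤ L (elemMap V)) :
    Submodule ℂ (Mat m n) where
  carrier := {V | L (elemMap V) = 0}
  zero_mem' := by
    change L (elemMap 0) = 0
    have : (elemMap 0 : MapSpace m n) = 0 := by
      ext1 X
      simp [elemMap_apply]
    rw [this, map_zero]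
  add_mem' := fun {V U} hV hU => by
    change L (elemMap V) = 0 at hV
    change L (elemMap U) = 0 at hU
    change L (elemMap (V + U)) = 0
    rw [elemMap_add, map_add, map_add, hV, hU, apply_crossMap_eq_zero hL hU, add_zero, add_zero]
  smul_mem' := fun c V hV => by
    change L (elemMap V) = 0 at hV
    change L (elemMap (c • V)) = 0
    rw [elemMap_smul, map_smul, hV, smul_zero]

theorem conjTranspose_vecMulVec_mul_mul (ξ ζ : Fin m → ℂ) (η θ : Fin n → ℂ) (X : Mat m m) :
    (Matrix.vecMulVec ξ η).conjTranspose * X * Matrix.vecMulVec ζ θ =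
      (star ξ ⬝ᵥ X.mulVec ζ) • Matrix.vecMulVec (star η) θ := by
  rw [Matrix.conjTranspose_vecMulVec, Matrix.vecMulVec_mul, Matrix.vecMulVec_mul_vecMulVec,
    Matrix.vecMulVec_smul, ← Matrix.dotProduct_mulVec]

theorem dotProduct_transpose_mulVec_comm (X : Mat m m) (ξ ζ : Fin m → ℂ) :
    ξ ⬝ᵥ X.transpose.mulVec ζ = ζ ⬝ᵥ X.mulVec ξ := by
  rw [Matrix.mulVec_transpose, dotProduct_comm, Matrix.dotProduct_mulVec]

/-- Composition with the transpose amounts to a partial conjugation, for elementary maps of product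
vectors. -/
theorem elemMap_vecMulVec_comp_transposeMap (ξ : Fin m → ℂ) (η : Fin n → ℂ) :
    elemMap (Matrix.vecMulVec ξ η) ∘ₗ transposeMap m = elemMap (Matrix.vecMulVec (star ξ) η) := by
  ext1 X
  rw [comp_transposeMap_apply, elemMap_apply, elemMap_apply, conjTranspose_vecMulVec_mul_mul,
    conjTranspose_vecMulVec_mul_mul, dotProduct_transpose_mulVec_comm, star_star]

/-- Composition with the transpose exchanges the two first factors in a cross term of product
vectors, up to conjugation. -/
theorem crossMap_vecMulVec_comp_transposeMap (ξ ζ : Fin m → ℂ) (η θ : Fin n → ℂ) :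
    crossMap (Matrix.vecMulVec (star ζ) η) (Matrix.vecMulVec (star ξ) θ) ∘ₗ transposeMap m =
      crossMap (Matrix.vecMulVec ξ η) (Matrix.vecMulVec ζ θ) := by
  ext1 X
  rw [comp_transposeMap_apply, crossMap_apply, crossMap_apply, conjTranspose_vecMulVec_mul_mul,
    conjTranspose_vecMulVec_mul_mul, conjTranspose_vecMulVec_mul_mul,
    conjTranspose_vecMulVec_mul_mul, dotProduct_transpose_mulVec_comm,
    dotProduct_transpose_mulVec_comm, star_star, star_star]

/-- A map `X ↦ W* Xᵗ W` that is a sum of elementary completely positive maps comes from a product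
vector `W`: a vector orthogonal to the first row of `W` is orthogonal to the first rows of all the
Kraus operators, hence to the second row of `W` unless the first row vanishes. -/
theorem isProductVector_of_comp_transposeMap_mem {n : ℕ} {D : Submodule ℂ (Mat 2 n)} {W : Mat 2 n}
    (hW : elemMap W ∘ₗ transposeMap 2 ∈ faceOf D) : IsProductVector W := by
  obtain ⟨k, V, -, h⟩ := hW
  have hent : ∀ p q a b, star (W q a) * W p b = ∑ i, star (V i p a) * V i q b := by
    intro p q a b
    have h1 := congrFun (congrFun (LinearMap.congr_fun h (Matrix.single p q 1)) a) b
    rw [comp_transposeMap_apply, Matrix.transpose_single, elemMap_single_apply,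
      LinearMap.sum_apply, Matrix.sum_apply] at h1
    simpa only [elemMap_single_apply] using h1
  by_cases h0 : W 0 = 0
  · rw [← isPure_rows_iff, rows_apply]
    exact ⟨0, 1, W 1, by rw [h0]; simp⟩
  obtain ⟨a₀, ha₀⟩ := Function.ne_iff.1 h0
  have hspan : W 1 ∈ (ℂ ∙ W 0) := by
    by_contra hc
    obtain ⟨x, hx1, hx2⟩ := exists_dotProduct_ne_zero_of_notMem hc
    have hx0 : W 0 ⬝ᵥ x = 0 := hx2 _ (Submodule.mem_span_singleton_self _)
    have hsq : ∑ i, star (V i 0 ⬝ᵥ x) * (V i 0 ⬝ᵥ x) = 0 := by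
      calc ∑ i, star (V i 0 ⬝ᵥ x) * (V i 0 ⬝ᵥ x)
          = ∑ a, ∑ b, (∑ i, star (V i 0 a) * V i 0 b) * (star (x a) * x b) := by
            simp only [dotProduct, star_sum, star_mul', Finset.sum_mul_sum]
            simp only [Finset.sum_mul]
            rw [Finset.sum_comm]
            refine Finset.sum_congr rfl fun a _ => ?_
            rw [Finset.sum_comm]
            exact Finset.sum_congr rfl fun b _ => Finset.sum_congr rfl fun i _ => by ring
        _ = star (W 0 ⬝ᵥ x) * (W 0 ⬝ᵥ x) := by
            simp only [← hent, dotProduct, star_sum, Finset.sum_mul_sum, star_mul']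
            exact Finset.sum_congr rfl fun a _ => Finset.sum_congr rfl fun b _ => by ring
        _ = 0 := by rw [hx0, mul_zero]
    have hV0 : ∀ i, V i 0 ⬝ᵥ x = 0 := by
      intro i
      have h2 := (Finset.sum_eq_zero_iff_of_nonneg fun i _ => star_mul_self_nonneg _).1 hsq i
        (Finset.mem_univ i)
      simpa using h2
    have h3 : star (W 0 a₀) * (W 1 ⬝ᵥ x) = 0 := by
      calc star (W 0 a₀) * (W 1 ⬝ᵥ x)
          = ∑ b, (∑ i, star (V i 1 a₀) * V i 0 b) * x b := by
            simp only [← hent, dotProduct, Finset.mul_sum, mul_assoc]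
        _ = ∑ i, star (V i 1 a₀) * (V i 0 ⬝ᵥ x) := by
            simp only [dotProduct, Finset.mul_sum, Finset.sum_mul, mul_assoc]
            exact Finset.sum_comm
        _ = 0 := by simp [hV0]
    rcases mul_eq_zero.1 h3 with h4 | h4
    · exact ha₀ (by simpa using h4)
    · exact hx1 h4
  obtain ⟨c, hc⟩ := Submodule.mem_span_singleton.1 hspan
  rw [← isPure_rows_iff, rows_apply]
  exact ⟨1, c, W 0, by rw [hc, one_smul]⟩

end Maps

/-! ### Consequences of exposedness -/

section Exposed

variable {n : ℕ}

/-- If `Φ_D` is exposed by `l`, the null spaces of the forms `V ↦ l (X ↦ V* X V)` and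
`W ↦ l (X ↦ W* Xᵗ W)` are `D` and a space of product vectors, the partial conjugates of those in
`D`.  Saturation holds since the cross term of the first form at `ξ ⊗ g` and `ζ ⊗ s` is the cross
term of the second one at `ζ̄ ⊗ g` and `ξ̄ ⊗ s`, which vanishes for `ξ ⊗ s ∈ D`. -/
theorem IsExposedFace.saturated {D : Submodule ℂ (Mat 2 n)}
    (h : IsExposedFace (faceOf D) (decCone 2 n)) :
    Saturated (rowSpace D) ∧ ∃ P : Submodule ℂ ((Fin n → ℂ) × (Fin n → ℂ)),
      ∀ v, v ∈ P ↔ v ∈ rowSpace D ∧ IsPure v := by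
  obtain ⟨l, hl, hF⟩ := h
  let l' : MapSpace 2 n →ₗ[ℝ] ℝ :=
    { toFun := fun φ => l (φ ∘ₗ transposeMap 2)
      map_add' := fun φ ψ => by rw [LinearMap.add_comp, map_add]
      map_smul' := fun c φ => by rw [LinearMap.smul_comp, map_smul, RingHom.id_apply] }
  have hl' : ∀ φ, l' φ = l (φ ∘ₗ transposeMap 2) := fun _ => rfl
  have hq : ∀ V, 0 ≤ l (elemMap V) := fun V => hl _ (mem_decCone_of_isCP (isCP_elemMap V))
  have hq' : ∀ V, 0 ≤ l' (elemMap V) := fun V =>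
    hl _ (mem_decCone_of_isCCP (isCCP_elemMap_comp_transposeMap V))
  have hD : ∀ V, V ∈ D ↔ l (elemMap V) = 0 := fun V => by
    rw [← elemMap_mem_faceOf_iff, hF]
    exact and_iff_right (mem_decCone_of_isCP (isCP_elemMap V))
  have hprod : ∀ ξ m, l' (elemMap (Matrix.vecMulVec ξ m)) =
      l (elemMap (Matrix.vecMulVec (star ξ) m)) := fun ξ m => by
    rw [hl', elemMap_vecMulVec_comp_transposeMap]
  have hnull : ∀ V, V ∈ nullSpace l' hq' ↔ l' (elemMap V) = 0 := fun _ => Iff.rfl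
  constructor
  · rintro a b s ⟨_, ⟨V, hV, rfl⟩, hVs⟩ hs
    by_cases hab : a = 0 ∧ b = 0
    · have : s = 0 := by rw [← hVs, hab.1, hab.2]; simp [contract_apply]
      subst this
      exact ⟨Submodule.zero_mem _, Submodule.zero_mem _⟩
    have hN : star a * a + star b * b ≠ 0 := by
      intro h0
      have h1 : Complex.normSq a + Complex.normSq b = 0 := by
        rw [Complex.star_def, ← Complex.normSq_eq_conj_mul_self,
          ← Complex.normSq_eq_conj_mul_self] at h0
        exact_mod_cast h0
      refine hab ⟨Complex.normSq_eq_zero.1 ?_, Complex.normSq_eq_zero.1 ?_⟩ <;>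
        linarith [Complex.normSq_nonneg a, Complex.normSq_nonneg b]
    set N : ℂ := star a * a + star b * b with hNdef
    have hVs' : (-b) • V 0 + a • V 1 = s := hVs
    -- the decomposition of `V` along the orthogonal basis `(a, b)`, `(-b̄, ā)` of `ℂ²`
    set g : Fin n → ℂ := N⁻¹ • (star a • V 0 + star b • V 1) with hg
    set A : Mat 2 n := Matrix.vecMulVec ![a, b] g with hA
    set B : Mat 2 n := Matrix.vecMulVec ![-star b, star a] (N⁻¹ • s) with hB
    have hVAB : V = A + B := by
      refine (rows n).injective ?_
      rw [map_add, hA, hB, rows_vecMulVec, rows_vecMulVec, rows_apply]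
      ext1
      · change V 0 = a • g + (-star b) • N⁻¹ • s
        rw [hg, ← hVs']
        match_scalars <;> field_simp <;> rw [hNdef] <;> ring
      · change V 1 = b • g + star a • N⁻¹ • s
        rw [hg, ← hVs']
        match_scalars <;> field_simp <;> rw [hNdef] <;> ring
    have hs' : l' (elemMap (Matrix.vecMulVec (star ![a, b]) (N⁻¹ • s))) = 0 := by
      rw [hprod, star_star, ← hD, ← smul_mem_rowSpace]
      have := Submodule.smul_mem _ N⁻¹ hs
      simpa only [Prod.smul_mk, smul_comm N⁻¹] using this
    have hcross := apply_crossMap_eq_zero hq' hs' (Matrix.vecMulVec (star ![-star b, star a]) g)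
    rw [hl', crossMap_vecMulVec_comp_transposeMap] at hcross
    have h0 := (hD V).1 hV
    rw [hVAB, elemMap_add, map_add, map_add, hcross, add_zero] at h0
    have hB0 : l (elemMap B) = 0 := by linarith [hq A, hq B]
    have hBD := smul_mem_rowSpace.2 ((hD B).2 hB0)
    constructor
    · convert Submodule.add_mem _ (Submodule.smul_mem _ (N⁻¹ * star a) hs)
        (Submodule.smul_mem _ (-b) hBD) using 1
      ext1
      · simp only [Prod.fst_add, Prod.smul_fst]
        match_scalars
        field_simp
        rw [hNdef]
        ring
      · simp only [Prod.snd_add, Prod.smul_snd]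
        module
    · convert Submodule.add_mem _ (Submodule.smul_mem _ (N⁻¹ * star b) hs)
        (Submodule.smul_mem _ a hBD) using 1
      ext1
      · simp only [Prod.fst_add, Prod.smul_fst]
        module
      · simp only [Prod.snd_add, Prod.smul_snd]
        match_scalars
        field_simp
        rw [hNdef]
        ring
  · refine exists_submodule_of_conj (E := rowSpace (nullSpace l' hq')) ?_ fun x y m => ?_
    · intro v hv
      obtain ⟨W, rfl⟩ := (rows n).surjective v
      rw [isPure_rows_iff]
      refine isProductVector_of_comp_transposeMap_mem (D := D) ((hF _).2 ⟨?_, ?_⟩)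
      · exact mem_decCone_of_isCCP (isCCP_elemMap_comp_transposeMap W)
      · exact rows_mem_rowSpace.1 hv
    · rw [smul_mem_rowSpace, smul_mem_rowSpace, hnull, hprod, hD]
      have : star ![x, y] = ![starRingEnd ℂ x, starRingEnd ℂ y] := by
        ext i
        fin_cases i <;> rfl
      rw [this]

end Exposed

/-! ### The pairing with separable matrices -/

section Pairing

variable {m n : ℕ}

/-- The pairing as a bilinear map. -/
def pairingMap (m n : ℕ) :
    Matrix (Fin n × Fin m) (Fin n × Fin m) ℂ →ₗ[ℂ] MapSpace m n →ₗ[ℂ] ℂ :=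
  LinearMap.mk₂ ℂ pairing
    (fun A B φ => by
      simp only [pairing, Matrix.submatrix_add, Pi.add_apply, Matrix.transpose_add, Matrix.mul_add,
        Matrix.trace_add, Finset.sum_add_distrib])
    (fun c A φ => by
      simp only [pairing, Matrix.submatrix_smul, Pi.smul_apply, Matrix.transpose_smul,
        Matrix.mul_smul, Matrix.trace_smul, Finset.smul_sum])
    (fun A φ ψ => by
      simp only [pairing, LinearMap.add_apply, Matrix.add_mul, Matrix.trace_add,
        Finset.sum_add_distrib])
    (fun c A φ => by
      simp only [pairing, LinearMap.smul_apply, Matrix.smul_mul, Matrix.trace_smul,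
        Finset.smul_sum])

theorem pairingMap_apply (A : Matrix (Fin n × Fin m) (Fin n × Fin m) ℂ) (φ : MapSpace m n) :
    pairingMap m n A φ = pairing A φ := rfl

open scoped MatrixOrder in
theorem posSemidef_trace_mul_nonneg {P Q : Mat n n} (hP : P.PosSemidef) (hQ : Q.PosSemidef) :
    0 ≤ Matrix.trace (P * Q) := by
  obtain ⟨B, rfl⟩ := CStarAlgebra.nonneg_iff_eq_star_mul_self.mp hQ.nonneg
  rw [Matrix.star_eq_conjTranspose, ← Matrix.mul_assoc, Matrix.trace_mul_comm, ← Matrix.mul_assoc]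
  exact (hP.mul_mul_conjTranspose_same B).trace_nonneg

theorem posSemidef_apply_of_mem_decCone {φ : MapSpace m n} (hφ : φ ∈ decCone m n) {x : Mat m m}
    (hx : x.PosSemidef) : (φ x).PosSemidef := by
  have key : ∀ (ι : Type) [Fintype ι] (V : ι → Mat m n) (y : Mat m m), y.PosSemidef →
      ((∑ i, elemMap (V i)) y).PosSemidef := by
    intro ι _ V y hy
    rw [LinearMap.sum_apply]
    exact Matrix.posSemidef_sum _ fun i _ => hy.conjTranspose_mul_mul_same (V i)
  obtain ⟨φ₁, h₁, φ₂, h₂, rfl⟩ := mem_decCone.1 hφ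
  obtain ⟨ι, _, V, rfl⟩ := h₁.exists_eq_sum_elemMap
  obtain ⟨κ, _, W, rfl⟩ := isCCP_exists_eq_sum_elemMap h₂
  refine (key ι V x hx).add ?_
  have := key κ W x.transpose hx.transpose
  rw [LinearMap.sum_apply] at this ⊢
  exact this

theorem pairing_nonneg {A : Matrix (Fin n × Fin m) (Fin n × Fin m) ℂ} (hA : A ∈ sepCone m n)
    {φ : MapSpace m n} (hφ : φ ∈ decCone m n) : 0 ≤ pairing A φ := by
  rw [← pairingMap_apply]
  induction hA using Submodule.span_induction with
  | mem A h =>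
    obtain ⟨y, x, hy, hx, rfl⟩ := h
    rw [pairingMap_apply, pairing_kronecker]
    exact posSemidef_trace_mul_nonneg (posSemidef_apply_of_mem_decCone hφ hx) hy.transpose
  | zero => simp
  | add A B _ _ h1 h2 =>
    rw [map_add, LinearMap.add_apply]
    exact add_nonneg h1 h2
  | smul c A _ h =>
    have : c • A = ((c : ℝ) : ℂ) • A := (Complex.coe_smul (c : ℝ) A).symm
    rw [this, map_smul, LinearMap.smul_apply, smul_eq_mul]
    exact mul_nonneg (by exact_mod_cast c.2) h

/-- The rank one matrix `ηη* ⊗ ξξ*`.  It pairs with `X ↦ V* X V` to the squared modulus of the inner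
product of `V` with the matrix `ξ ηᵗ`; there is no conjugate on `η`, since the pairing involves the
transpose of the first factor. -/
def productState (ξ : Fin m → ℂ) (η : Fin n → ℂ) : Matrix (Fin n × Fin m) (Fin n × Fin m) ℂ :=
  Matrix.kronecker (Matrix.vecMulVec η (star η)) (Matrix.vecMulVec ξ (star ξ))

theorem productState_mem_sepCone (ξ : Fin m → ℂ) (η : Fin n → ℂ) :
    productState ξ η ∈ sepCone m n :=
  PointedCone.subset_hull ⟨_, _, Matrix.posSemidef_vecMulVec_self_star η,
    Matrix.posSemidef_vecMulVec_self_star ξ, rfl⟩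

theorem pairing_productState_elemMap (ξ : Fin m → ℂ) (η : Fin n → ℂ) (V : Mat m n) :
    pairing (productState ξ η) (elemMap V) =
      Complex.normSq (Matrix.trace ((Matrix.vecMulVec ξ η).conjTranspose * V)) := by
  have h : elemMap V (Matrix.vecMulVec ξ (star ξ)) =
      Matrix.vecMulVec (star (Matrix.vecMul (star ξ) V)) (Matrix.vecMul (star ξ) V) := by
    rw [elemMap_apply, Matrix.mul_vecMulVec, Matrix.vecMulVec_mul, Matrix.star_vecMul, star_star]
  rw [productState, pairing_kronecker, h, Matrix.transpose_vecMulVec,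
    Matrix.vecMulVec_mul_vecMulVec, Matrix.trace_vecMulVec, Matrix.conjTranspose_vecMulVec,
    Matrix.vecMulVec_mul, Matrix.trace_vecMulVec, dotProduct_smul, smul_eq_mul,
    Complex.normSq_eq_conj_mul_self, ← Complex.star_def, Matrix.star_dotProduct,
    dotProduct_comm (star η), mul_comm]

theorem pairing_productState_elemMap_comp_transposeMap (ξ : Fin m → ℂ) (η : Fin n → ℂ)
    (V : Mat m n) :
    pairing (productState ξ η) (elemMap V ∘ₗ transposeMap m) =
      Complex.normSq (Matrix.trace ((Matrix.vecMulVec (star ξ) η).conjTranspose * V)) := by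
  rw [← pairing_productState_elemMap, productState, productState, pairing_kronecker,
    pairing_kronecker, comp_transposeMap_apply, Matrix.transpose_vecMulVec, star_star]

/-- Finitely many product vectors of a subspace suffice to test orthogonality against all of them
and against all their partial conjugates; the sum of their product states is a separable matrix
that detects both. -/
theorem exists_sepCone_pairing (C : Submodule ℂ (Mat m n)) :
    ∃ A ∈ sepCone m n,
      (∀ V, pairing A (elemMap V) = 0 ↔ ∀ ξ η, Matrix.vecMulVec ξ η ∈ C →
        Matrix.trace ((Matrix.vecMulVec ξ η).conjTranspose * V) = 0) ∧
      (∀ V, pairing A (elemMap V ∘ₗ transposeMap m) = 0 ↔ ∀ ξ η, Matrix.vecMulVec ξ η ∈ C →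
        Matrix.trace ((Matrix.vecMulVec (star ξ) η).conjTranspose * V) = 0) := by
  classical
  let f : (Fin m → ℂ) × (Fin n → ℂ) → Mat m n × Mat m n := fun z =>
    (Matrix.vecMulVec z.1 z.2, Matrix.vecMulVec (star z.1) z.2)
  obtain ⟨t, ht, hspan⟩ := (Submodule.fg_span_iff_fg_span_finset_subset
    (R := ℂ) (f '' {z | Matrix.vecMulVec z.1 z.2 ∈ C})).1 (IsNoetherian.noetherian _)
  obtain ⟨s, hs, rfl⟩ := Finset.subset_set_image_iff.1 ht
  have hmem : ∀ (U : Submodule ℂ (Mat m n × Mat m n)), (∀ z ∈ s, f z ∈ U) →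
      ∀ ξ η, Matrix.vecMulVec ξ η ∈ C → f (ξ, η) ∈ U := by
    intro U hU ξ η hξη
    have h1 : Submodule.span ℂ (f '' {z | Matrix.vecMulVec z.1 z.2 ∈ C}) ≤ U := by
      rw [hspan, Submodule.span_le]
      intro v hv
      obtain ⟨z, hz, rfl⟩ := Finset.mem_image.1 (Finset.mem_coe.1 hv)
      exact hU z hz
    exact h1 (Submodule.subset_span ⟨(ξ, η), hξη, rfl⟩)
  have hnull : ∀ V Z : Mat m n, Z ∈ orthCompl (ℂ ∙ V) ↔
      Matrix.trace (Z.conjTranspose * V) = 0 := by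
    intro V Z
    rw [trace_conjTranspose_mul_eq_star, star_eq_zero]
    refine ⟨fun h => h V (Submodule.mem_span_singleton_self V), fun h X hX => ?_⟩
    obtain ⟨c, rfl⟩ := Submodule.mem_span_singleton.1 hX
    rw [Matrix.conjTranspose_smul, Matrix.smul_mul, Matrix.trace_smul, h, smul_zero]
  have hsum : ∀ (g : (Fin m → ℂ) × (Fin n → ℂ) → ℂ),
      (∑ z ∈ s, (Complex.normSq (g z) : ℂ) = 0 ↔ ∀ z ∈ s, g z = 0) := by
    intro g
    rw [← Complex.ofReal_sum, Complex.ofReal_eq_zero,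
      Finset.sum_eq_zero_iff_of_nonneg fun _ _ => Complex.normSq_nonneg _]
    simp only [Complex.normSq_eq_zero]
  refine ⟨∑ z ∈ s, productState z.1 z.2,
    Submodule.sum_mem _ fun z _ => productState_mem_sepCone z.1 z.2, fun V => ?_, fun V => ?_⟩
  · rw [← pairingMap_apply, map_sum, LinearMap.sum_apply]
    simp only [pairingMap_apply, pairing_productState_elemMap]
    rw [hsum]
    constructor
    · intro h ξ η hξη
      rw [← hnull]
      exact hmem ((orthCompl (ℂ ∙ V)).comap (LinearMap.fst ℂ _ _))
        (fun z hz => (hnull _ _).2 (h z hz)) ξ η hξη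
    · intro h z hz
      exact h _ _ (hs hz)
  · rw [← pairingMap_apply, map_sum, LinearMap.sum_apply]
    simp only [pairingMap_apply, pairing_productState_elemMap_comp_transposeMap]
    rw [hsum]
    constructor
    · intro h ξ η hξη
      rw [← hnull]
      exact hmem ((orthCompl (ℂ ∙ V)).comap (LinearMap.snd ℂ _ _))
        (fun z hz => (hnull _ _).2 (h z hz)) ξ η hξη
    · intro h z hz
      exact h _ _ (hs hz)

theorem IsFaceExposedBySeparable.isExposedFace {F : PointedCone ℝ (MapSpace m n)}
    (h : IsFaceExposedBySeparable F) : IsExposedFace F (decCone m n) := by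
  obtain ⟨-, A, hA, hF⟩ := h
  refine ⟨Complex.reLm ∘ₗ (pairingMap m n A).restrictScalars ℝ, fun φ hφ => ?_, fun φ => ?_⟩
  · exact (Complex.nonneg_iff.1 (pairing_nonneg hA hφ)).1
  · rw [hF]
    refine and_congr_right fun hφ => ?_
    have h0 := (Complex.nonneg_iff.1 (pairing_nonneg hA hφ)).2
    exact ⟨fun h => by simp [pairingMap_apply, h], fun h => Complex.ext h h0.symm⟩

theorem isFaceExposedBySeparable_of_mem_iff {F : PointedCone ℝ (MapSpace m n)}
    {A : Matrix (Fin n × Fin m) (Fin n × Fin m) ℂ} (hA : A ∈ sepCone m n)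
    (hF : ∀ φ, φ ∈ F ↔ φ ∈ decCone m n ∧ pairing A φ = 0) : IsFaceExposedBySeparable F := by
  refine ⟨⟨fun φ hφ => ((hF φ).1 hφ).1, fun {φ ψ a} hφ hψ ha h => (hF φ).2 ⟨hφ, ?_⟩⟩, A, hA, hF⟩
  have h1 := ((hF _).1 h).2
  have h2 : a • φ = (a : ℂ) • φ := (Complex.coe_smul a φ).symm
  rw [h2, ← pairingMap_apply, map_add, map_smul, smul_eq_mul, pairingMap_apply,
    pairingMap_apply] at h1
  have ha' : (0 : ℂ) ≤ a := by exact_mod_cast ha.le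
  have h3 := ((add_eq_zero_iff_of_nonneg (mul_nonneg ha' (pairing_nonneg hA hφ))
    (pairing_nonneg hA hψ)).1 h1).1
  exact (mul_eq_zero.1 h3).resolve_left (by exact_mod_cast ha.ne')

end Pairing

/-! ### Faces exposed by separable states -/

section Separable

variable {n : ℕ}

/-- The sum of product states over a sufficiently rich finite set of product vectors of `D^⊥`
exposes `Φ_D`. -/
theorem isFaceExposedBySeparable_faceOf {D : Submodule ℂ (Mat 2 n)}
    (hP : ∃ P : Submodule ℂ ((Fin n → ℂ) × (Fin n → ℂ)),
      ∀ v, v ∈ P ↔ v ∈ rowSpace D ∧ IsPure v)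
    (hD : ∀ w, (∀ α β, contract α β w ∈ (rowSpace D).map (contract α β)) → w ∈ rowSpace D) :
    IsFaceExposedBySeparable (faceOf D) := by
  obtain ⟨P, hP⟩ := hP
  obtain ⟨A, hA, h1, h2⟩ := exists_sepCone_pairing (orthCompl D)
  have hsum : ∀ (ι : Type) [Fintype ι] (φ : ι → MapSpace 2 n), (∀ i, φ i ∈ decCone 2 n) →
      pairing A (∑ i, φ i) = 0 → ∀ i, pairing A (φ i) = 0 := by
    intro ι _ φ hφ h i
    rw [← pairingMap_apply, map_sum] at h
    exact (Finset.sum_eq_zero_iff_of_nonneg fun i _ => pairing_nonneg hA (hφ i)).1 h i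
      (Finset.mem_univ i)
  refine isFaceExposedBySeparable_of_mem_iff hA fun φ => ⟨fun hφ => ?_, ?_⟩
  · refine ⟨faceOf_le_decCone D hφ, ?_⟩
    obtain ⟨k, V, hV, rfl⟩ := hφ
    rw [← pairingMap_apply, map_sum]
    refine Finset.sum_eq_zero fun i _ => (h1 (V i)).2 fun ξ η hξη => ?_
    rw [trace_conjTranspose_mul_eq_star, hξη _ (hV i), star_zero]
  · rintro ⟨hφ, h0⟩
    obtain ⟨φ₁, hφ₁, φ₂, hφ₂, rfl⟩ := mem_decCone.1 hφ
    rw [← pairingMap_apply, map_add, pairingMap_apply, pairingMap_apply,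
      add_eq_zero_iff_of_nonneg (pairing_nonneg hA (mem_decCone_of_isCP hφ₁))
        (pairing_nonneg hA (mem_decCone_of_isCCP hφ₂))] at h0
    obtain ⟨ι, _, V, rfl⟩ := hφ₁.exists_eq_sum_elemMap
    obtain ⟨κ, _, W, rfl⟩ := isCCP_exists_eq_sum_elemMap hφ₂
    refine (faceOf D).add_mem (Submodule.sum_mem _ fun i _ => ?_)
      (Submodule.sum_mem _ fun i _ => ?_)
    · have hi := (h1 _).1
        (hsum ι _ (fun i => mem_decCone_of_isCP (isCP_elemMap (V i))) h0.1 i)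
      refine elemMap_mem_faceOf (rows_mem_rowSpace.1 (hD _ ?_))
      rw [contract_mem_iff_forall_trace_eq_zero]
      rintro _ hZ ⟨ξ, η, rfl⟩
      exact hi ξ (star η) hZ
    · have hi := (h2 _).1 (hsum κ _
        (fun i => mem_decCone_of_isCCP (isCCP_elemMap_comp_transposeMap (W i))) h0.2 i)
      obtain ⟨a, b, m, hW, hmem⟩ := (saturated_of_contract_closed hD).exists_of_contract_mem_conj hP
        (contract_mem_conj_of_forall_trace_eq_zero hi)
      have hW' : W i = Matrix.vecMulVec (star ![a, b]) m := (rows n).injective hW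
      rw [hW', elemMap_vecMulVec_comp_transposeMap, star_star]
      exact elemMap_mem_faceOf (smul_mem_rowSpace.1 hmem)

end Separable

end Decomp

theorem mainTheorem1 (n : ℕ) (D : Submodule ℂ (Decomp.Mat 2 n)) :
    List.TFAE [
      Decomp.IsExposedFace (Decomp.faceOf D) (Decomp.decCone 2 n),
      Decomp.IsFaceExposedBySeparable (Decomp.faceOf D),
      (∃ D₁ : Submodule ℂ (Decomp.Mat 2 n),
          (D₁ : Set (Decomp.Mat 2 n)) = {V | V ∈ D ∧ Decomp.IsProductVector V}) ∧
        Submodule.span ℂ {W | W ∈ Decomp.orthCompl D ∧ Decomp.IsProductVector W} =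
          Decomp.orthCompl D] := by
  rw [Decomp.exists_submodule_productVectors_iff, Decomp.span_productVectors_eq_orthCompl_iff]
  tfae_have 2 → 1 := Decomp.IsFaceExposedBySeparable.isExposedFace
  tfae_have 1 → 3 := fun h => by
    obtain ⟨hsat, P, hP⟩ := h.saturated
    exact ⟨⟨P, hP⟩, fun w hw => hsat.mem_of_contract_mem hP hw⟩
  tfae_have 3 → 2 := fun h => Decomp.isFaceExposedBySeparable_faceOf h.1 h.2
  tfae_finish
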